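/- A polytope is the convex hull of a non-empty finite set of points in $\mathbb{R}^n$, and its dimension is that of its affine hull. For $c\in\mathbb{R}^n$ let $P^c$ be the face of $P$ on which $x\mapsto\langle c,x\rangle$ is maximal. Polytopes $P,Q\subset\mathbb{R}^n$ are *normally equivalent* ($P\simeq Q$) if for every $c\in\mathbb{R}^n$ the affine hulls of $P^c$ and $Q^c$ differ by a translation. A polytope is *inscribed* if its vertices lie on a common sphere; $c(Q)$ denotes the centre of that sphere relative to the affine hull of $Q$, i.e. the unique point of the affine hull that is equidistant from all vertices of $Q$. For a polytope $P\subset\mathbb{R}^n$ let $\mathrm{InCone}(P)$ be the set of inscribed polytopes $Q\subset\mathbb{R}^n$ with $Q\simeq P$, modulo translations, with the metric given by the Hausdorff distance between the centred representatives $Q-c(Q)$, and with the operations induced by Minkowski sum and by dilation. **Theorem 1.1.** Let $P\subset\mathbb{R}^n$ be a $d$-dimensional polytope. If $Q,Q'\simeq P$ are inscribed, then $Q+Q'$ is normally equivalent to $P$ and inscribed, i.e. $Q+Q'\in\mathrm{InCone}(P)$. Moreover $\mathrm{InCone}(P)$ has the structure of an open polyhedral cone of dimension at most $d$: there are a set $C=\{x\in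 L: f_1(x)>0,\dots,f_m(x)>0\}\subseteq\mathbb{R}^n$, where $L$ is a linear subspace and $f_1,\dots,f_m$ are linear functionals (so $C$ is relatively open, and empty exactly if $\mathrm{InCone}(P)=\emptyset$), with $\dim\operatorname{span}(C)\le d$, and a homeomorphism $\varphi:\mathrm{InCone}(P)\to C$ such that $\varphi(q+q')=\varphi(q)+\varphi(q')$ and $\varphi(t\,q)=t\,\varphi(q)$ for all $q,q'\in\mathrm{InCone}(P)$ and all real $t>0$ (in particular $q+q'$ and $t\,q$ lie in $\mathrm{InCone}(P)$). -/

import Mathlib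

open scoped Pointwise RealInnerProductSpace Affine

/-- A non-empty convex polytope in `ℝⁿ`: the convex hull of a non-empty finite set of points. -/
@[ext]
structure Polytope (n : ℕ) where
  carrier : Set (EuclideanSpace ℝ (Fin n))
  exists_finset : ∃ s : Finset (EuclideanSpace ℝ (Fin n)),
    s.Nonempty ∧ carrier = convexHull ℝ (s : Set (EuclideanSpace ℝ (Fin n)))

namespace Polytope

variable {n : ℕ}

/-- The dimension of a polytope is the dimension of its affine hull. -/
noncomputable def dim (P : Polytope n) : ℕ :=
  Module.finrank ℝ (affineSpan ℝ P.carrier).direction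

/-- The set of vertices. -/
def vertices (P : Polytope n) : Set (EuclideanSpace ℝ (Fin n)) :=
  P.carrier.extremePoints ℝ

/-- The face of `P` on which the linear function `⟪c, ·⟫` is maximal. -/
def face (P : Polytope n) (c : EuclideanSpace ℝ (Fin n)) : Set (EuclideanSpace ℝ (Fin n)) :=
  {x | x ∈ P.carrier ∧ ∀ y ∈ P.carrier, ⟪c, y⟫ ≤ ⟪c, x⟫}

/-- Normal equivalence: for every `c`, the affine hulls of the faces of `P` and `Q` in
direction `c` differ by a translation. -/
def NormallyEquivalent (P Q : Polytope n) : Prop :=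
  ∀ c : EuclideanSpace ℝ (Fin n), affineSpan ℝ (P.face c) ∥ affineSpan ℝ (Q.face c)

/-- A polytope is inscribed if its vertices lie on a common sphere. -/
def IsInscribed (P : Polytope n) : Prop :=
  EuclideanGeometry.Cospherical P.vertices

/-- Minkowski sum. -/
instance : Add (Polytope n) where
  add P Q := ⟨P.carrier + Q.carrier, by
    classical
    obtain ⟨s, hs, hP⟩ := P.exists_finset
    obtain ⟨t, ht, hQ⟩ := Q.exists_finset
    exact ⟨s + t, hs.add ht, by rw [hP, hQ, Finset.coe_add, convexHull_add]⟩⟩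

/-- Dilation. -/
noncomputable instance : SMul ℝ (Polytope n) where
  smul r P := ⟨r • P.carrier, by
    classical
    obtain ⟨s, hs, hP⟩ := P.exists_finset
    exact ⟨r • s, hs.smul_finset, by rw [hP, Finset.coe_smul_finset, convexHull_smul]⟩⟩

/-- Translation. -/
noncomputable instance : VAdd (EuclideanSpace ℝ (Fin n)) (Polytope n) where
  vadd x P := ⟨x +ᵥ P.carrier, by
    classical
    obtain ⟨s, hs, hP⟩ := P.exists_finset
    exact ⟨x +ᵥ s, hs.vadd_finset, by rw [hP, Finset.coe_vadd_finset, convexHull_vadd]⟩⟩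

@[simp] theorem carrier_add (P Q : Polytope n) : (P + Q).carrier = P.carrier + Q.carrier := rfl

@[simp] theorem carrier_smul (r : ℝ) (P : Polytope n) : (r • P).carrier = r • P.carrier := rfl

@[simp] theorem carrier_vadd (x : EuclideanSpace ℝ (Fin n)) (P : Polytope n) :
    (x +ᵥ P).carrier = x +ᵥ P.carrier := rfl

/-- Two polytopes are identified if they are translates of each other. -/
instance translationSetoid (n : ℕ) : Setoid (Polytope n) where
  r P Q := ∃ x : EuclideanSpace ℝ (Fin n), Q = x +ᵥ P
  iseqv :=
    { refl := fun P => ⟨0, by ext1; simp⟩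
      symm := by
        rintro P Q ⟨x, rfl⟩
        exact ⟨-x, by ext1; simp⟩
      trans := by
        rintro P Q R ⟨x, rfl⟩ ⟨y, rfl⟩
        exact ⟨y + x, by ext1; simp [add_vadd]⟩ }

theorem isCompact_carrier (P : Polytope n) : IsCompact P.carrier := by
  obtain ⟨s, -, h⟩ := P.exists_finset
  rw [h]
  exact s.finite_toSet.isCompact_convexHull ℝ

theorem convex_carrier (P : Polytope n) : Convex ℝ P.carrier := by
  obtain ⟨s, -, h⟩ := P.exists_finset
  rw [h]
  exact convex_convexHull ℝ _

theorem nonempty_carrier (P : Polytope n) : P.carrier.Nonempty := by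
  obtain ⟨s, hs, h⟩ := P.exists_finset
  rw [h]
  exact convexHull_nonempty_iff.2 hs

/-- A polytope as a non-empty compact set; the type of these carries the Hausdorff metric. -/
def toNonemptyCompacts (P : Polytope n) :
    TopologicalSpace.NonemptyCompacts (EuclideanSpace ℝ (Fin n)) :=
  ⟨⟨P.carrier, P.isCompact_carrier⟩, P.nonempty_carrier⟩

/-- `c` is the centre of the sphere inscribing `P` relative to its affine hull. -/
def IsCenter (P : Polytope n) (c : EuclideanSpace ℝ (Fin n)) : Prop :=
  c ∈ affineSpan ℝ P.carrier ∧ ∃ r : ℝ, ∀ v ∈ P.vertices, dist v c = r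

theorem affineSpan_vertices (P : Polytope n) :
    affineSpan ℝ P.vertices = affineSpan ℝ P.carrier := by
  apply le_antisymm (affineSpan_mono ℝ extremePoints_subset)
  rw [affineSpan_le]
  have h := closure_convexHull_extremePoints P.isCompact_carrier P.convex_carrier
  exact h.symm.subset.trans (closure_minimal (convexHull_subset_affineSpan _)
    (AffineSubspace.closed_of_finiteDimensional _))

theorem IsInscribed.exists_isCenter {P : Polytope n} (h : P.IsInscribed) :
    ∃ c, P.IsCenter c := by
  have : Nonempty (affineSpan ℝ P.carrier) :=
    ((affineSpan_nonempty ℝ).2 P.nonempty_carrier).to_subtype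
  have hs : P.vertices ⊆ affineSpan ℝ P.carrier :=
    extremePoints_subset.trans (subset_affineSpan ℝ _)
  obtain ⟨c, r, hr⟩ := h
  obtain ⟨r', h'⟩ :=
    (EuclideanGeometry.exists_dist_eq_iff_exists_dist_orthogonalProjection_eq hs c).1 ⟨r, hr⟩
  exact ⟨_, EuclideanGeometry.orthogonalProjection_mem c, r', h'⟩

theorem IsCenter.unique {P : Polytope n} {c c' : EuclideanSpace ℝ (Fin n)}
    (h : P.IsCenter c) (h' : P.IsCenter c') : c = c' := by
  obtain ⟨hc, r, hr⟩ := h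
  obtain ⟨hc', r', hr'⟩ := h'
  have hmem : c - c' ∈ (affineSpan ℝ P.vertices).direction := by
    rw [affineSpan_vertices]
    exact AffineSubspace.vsub_mem_direction hc hc'
  have horth : (affineSpan ℝ P.vertices).direction ≤ (ℝ ∙ (c - c'))ᗮ := by
    rw [direction_affineSpan, vectorSpan_def, Submodule.span_le]
    rintro _ ⟨p, hp, q, hq, rfl⟩
    rw [SetLike.mem_coe, Submodule.mem_orthogonal_singleton_iff_inner_right]
    have h1 := (hr p hp).trans (hr q hq).symm
    have h2 := (hr' p hp).trans (hr' q hq).symm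
    rw [dist_eq_norm, dist_eq_norm] at h1 h2
    have e1 : ⟪p - c, p - c⟫ = ⟪q - c, q - c⟫ := by
      rw [real_inner_self_eq_norm_sq, real_inner_self_eq_norm_sq, h1]
    have e2 : ⟪p - c', p - c'⟫ = ⟪q - c', q - c'⟫ := by
      rw [real_inner_self_eq_norm_sq, real_inner_self_eq_norm_sq, h2]
    simp only [vsub_eq_sub, inner_sub_left, inner_sub_right] at e1 e2 ⊢
    rw [real_inner_comm p c, real_inner_comm q c] at e1
    rw [real_inner_comm p c', real_inner_comm q c'] at e2
    linarith [real_inner_comm p c, real_inner_comm q c, real_inner_comm p c',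
      real_inner_comm q c']
  have h0 := Submodule.mem_orthogonal_singleton_iff_inner_right.1 (horth hmem)
  exact sub_eq_zero.1 (inner_self_eq_zero.1 h0)

open Classical in
/-- The centre `c(P)` of an inscribed polytope (and `0` if `P` is not inscribed). -/
noncomputable def center (P : Polytope n) : EuclideanSpace ℝ (Fin n) :=
  if h : ∃ c, P.IsCenter c then h.choose else 0

theorem IsCenter.center_eq {P : Polytope n} {c : EuclideanSpace ℝ (Fin n)}
    (h : P.IsCenter c) : P.center = c := by
  have hex : ∃ c, P.IsCenter c := ⟨c, h⟩
  rw [center, dif_pos hex]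
  exact hex.choose_spec.unique h

theorem IsCenter.vadd {P : Polytope n} {c : EuclideanSpace ℝ (Fin n)}
    (h : P.IsCenter c) (x : EuclideanSpace ℝ (Fin n)) : (x +ᵥ P).IsCenter (x +ᵥ c) := by
  obtain ⟨hc, r, hr⟩ := h
  refine ⟨?_, r, fun v hv => ?_⟩
  · rw [carrier_vadd, ← AffineSubspace.pointwise_vadd_span]
    exact AffineSubspace.vadd_mem_pointwise_vadd_iff.2 hc
  · have hv' : -x +ᵥ v ∈ P.vertices := by
      obtain ⟨hm, he⟩ := mem_extremePoints_iff_left.1 hv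
      refine mem_extremePoints_iff_left.2
        ⟨Set.mem_vadd_set_iff_neg_vadd_mem.1 hm, fun a ha b hb hab => ?_⟩
      have := he (x +ᵥ a) (Set.vadd_mem_vadd_set ha) (x +ᵥ b) (Set.vadd_mem_vadd_set hb) (by
        have h2 := (mem_openSegment_translate ℝ x).2 hab
        simpa using h2)
      rw [← this, neg_vadd_vadd]
    rw [← hr _ hv', dist_eq_norm, dist_eq_norm]
    congr 1
    simp only [vadd_eq_add]
    abel

theorem IsInscribed.isCenter_center {P : Polytope n} (h : P.IsInscribed) :
    P.IsCenter P.center := by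
  obtain ⟨c, hc⟩ := h.exists_isCenter
  rwa [hc.center_eq]

theorem IsInscribed.vadd {P : Polytope n} (h : P.IsInscribed)
    (x : EuclideanSpace ℝ (Fin n)) : (x +ᵥ P).IsInscribed := by
  obtain ⟨c, hc⟩ := h.exists_isCenter
  exact ⟨_, (hc.vadd x).2⟩

/-- The translate of `P` whose centre is the origin. -/
noncomputable def centered (P : Polytope n) : Polytope n := (-P.center) +ᵥ P

theorem IsInscribed.centered_vadd {P : Polytope n} (h : P.IsInscribed)
    (x : EuclideanSpace ℝ (Fin n)) : (x +ᵥ P).centered = P.centered := by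
  ext1
  rw [centered, centered, (h.isCenter_center.vadd x).center_eq]
  simp only [carrier_vadd, vadd_vadd]
  congr 1
  simp only [vadd_eq_add]
  abel

theorem toNonemptyCompacts_injective :
    Function.Injective (toNonemptyCompacts : Polytope n → _) := by
  intro P Q h
  ext1
  exact congrArg (fun K : TopologicalSpace.NonemptyCompacts (EuclideanSpace ℝ (Fin n)) =>
    (K : Set (EuclideanSpace ℝ (Fin n)))) h

end Polytope

/-- The translation classes of polytopes in `ℝⁿ`. -/
def TranslationClass (n : ℕ) : Type := Quotient (Polytope.translationSetoid n)

namespace TranslationClass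

variable {n : ℕ}

/-- The class of a polytope. -/
def mk (P : Polytope n) : TranslationClass n := Quotient.mk _ P

/-- Minkowski sum of translation classes. -/
instance : Add (TranslationClass n) where
  add := Quotient.map₂ (· + ·) (by
    rintro P _ ⟨x, rfl⟩ Q _ ⟨y, rfl⟩
    exact ⟨x + y, by 
      ext1
      simp only [Polytope.carrier_add, Polytope.carrier_vadd, ← Set.singleton_vadd, vadd_eq_add,
        ← Set.singleton_add_singleton]
      abel⟩)

/-- Dilation of translation classes. -/
noncomputable instance : SMul ℝ (TranslationClass n) where
  smul r := Quotient.map (r • ·) (by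
    rintro P _ ⟨x, rfl⟩
    exact ⟨r • x, by 
      ext1
      simp only [Polytope.carrier_smul, Polytope.carrier_vadd, ← Set.singleton_vadd, vadd_eq_add,
        smul_add, Set.smul_set_singleton]⟩)

theorem mk_add (P Q : Polytope n) : mk (P + Q) = mk P + mk Q := rfl

theorem mk_smul (r : ℝ) (P : Polytope n) : mk (r • P) = r • mk P := rfl

/-- The representative of a class of inscribed polytopes that is centred at the origin. -/
noncomputable def centeredRep (q : TranslationClass n) : Polytope n :=
  (Quotient.out q).centered

theorem centeredRep_mk {P : Polytope n} (h : P.IsInscribed) :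
    (mk P).centeredRep = P.centered := by
  obtain ⟨x, hx⟩ : Polytope.translationSetoid n P (Quotient.out (mk P)) :=
    Setoid.symm (Quotient.mk_out P)
  rw [centeredRep, hx, h.centered_vadd]

theorem mk_centeredRep (q : TranslationClass n) : mk q.centeredRep = q := by
  conv_rhs => rw [← Quotient.out_eq q]
  exact Quotient.sound (Setoid.symm ⟨_, rfl⟩)

theorem centeredRep_injective :
    Function.Injective (centeredRep : TranslationClass n → Polytope n) := by
  intro q q' h
  rw [← mk_centeredRep q, h, mk_centeredRep]

end TranslationClass

namespace Polytope

variable {n : ℕ}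

/-- The inscribed cone of `P`: the inscribed polytopes that are normally equivalent to `P`,
modulo translations. -/
def InCone (P : Polytope n) : Set (TranslationClass n) :=
  {q | ∃ Q : Polytope n, Q.NormallyEquivalent P ∧ Q.IsInscribed ∧ TranslationClass.mk Q = q}

/-- The metric on the inscribed cone: the Hausdorff distance of the representatives that are
centred at the origin. -/
noncomputable instance (P : Polytope n) : MetricSpace P.InCone :=
  MetricSpace.induced
    (fun q : P.InCone => (TranslationClass.centeredRep (q : TranslationClass n)).toNonemptyCompacts)
    (toNonemptyCompacts_injective.comp
      (TranslationClass.centeredRep_injective.comp Subtype.val_injective))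
    inferInstance

end Polytope

/-- An open polyhedral cone (open relative to a linear subspace): the set of points of a linear
subspace that satisfy finitely many strict homogeneous linear inequalities. -/
def IsOpenPolyhedralCone {V : Type*} [AddCommGroup V] [Module ℝ V] (C : Set V) : Prop :=
  ∃ (L : Submodule ℝ V) (A : Finset (Module.Dual ℝ V)), C = {x | x ∈ L ∧ ∀ f ∈ A, 0 < f x}

/-! Index the vertices of `P` by a finite set as a family `v`, and encode a family `x` of points by
the index sets `argmax x c`. Every vertex is the unique maximizer in some direction, and normal
equivalence fixes the directions whose face is a point. Connectedness of segments of directions then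
turns this into a bijection of vertices. So the polytopes normally equivalent to `P` are exactly the
hulls of families `x` with `argmax x c = argmax v c` for all `c` (`exists_bijective_argmax_comp_eq`,
`vectorSpan_image_argmax_le`), and on such families Minkowski sum is pointwise addition.

This condition is open polyhedral: the normal cone of each vertex is finitely generated, so it
suffices to prescribe finitely many signs of linear functionals of `x`
(`isOpenPolyhedralCone_argmax_eq`).

With the centre at the origin, being inscribed means that all `‖x i‖` agree. This quadratic
condition becomes linear because edge directions are known: for an edge `ab` it says `x a + x b ⟂ v
a - v b`. Since the edge graph is connected, these edge conditions suffice
(`norm_eq_of_mem_inscribedSubmodule`, `mem_inscribedSubmodule_of_norm_eq`). The inscribed cone is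
thus an open polyhedral cone cut by a linear subspace, which gives closure under sums.

On that subspace `x i = 0` forces every norm to vanish, so evaluation at one vertex is injective and
carries the cone into the direction space of `P`, of dimension `d`. Lipschitz estimates in both
directions compare the Hausdorff metric with the position of the vertices. -/

/-! ### Maximizers of linear functions along finite families -/

section Argmax

open Filter Topology

variable {E : Type*} [NormedAddCommGroup E] [InnerProductSpace ℝ E] {ι κ : Type*}

/-- The indices at which the linear function `⟪c, ·⟫` is maximal along the family `x`. -/
def argmax (x : ι → E) (c : E) : Set ι :=
  {i | ∀ j, ⟪c, x j⟫ ≤ ⟪c, x i⟫}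

theorem argmax_nonempty [Finite ι] [Nonempty ι] (x : ι → E) (c : E) : (argmax x c).Nonempty :=
  Finite.exists_max fun i => ⟪c, x i⟫

theorem inner_eq_of_mem_argmax {x : ι → E} {c : E} {i j : ι} (hi : i ∈ argmax x c)
    (hj : j ∈ argmax x c) : ⟪c, x i⟫ = ⟪c, x j⟫ :=
  le_antisymm (hj i) (hi j)

theorem mem_argmax_of_inner_eq {x : ι → E} {c : E} {i j : ι} (hi : i ∈ argmax x c)
    (h : ⟪c, x j⟫ = ⟪c, x i⟫) : j ∈ argmax x c :=
  fun k => (hi k).trans h.ge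

theorem argmax_zero (x : ι → E) : argmax x 0 = Set.univ := by
  ext i
  simp [argmax]

theorem argmax_sub_const (x : ι → E) (a c : E) : argmax (fun i => x i - a) c = argmax x c := by
  ext i
  simp [argmax, inner_sub_right]

theorem argmax_smul (x : ι → E) {t : ℝ} (ht : 0 < t) (c : E) : argmax (t • x) c = argmax x c := by
  ext i
  simp [argmax, inner_smul_right, ht]

theorem argmax_comp_surjective {y : κ → E} {f : ι → κ} (hf : f.Surjective) (c : E) :
    argmax (y ∘ f) c = f ⁻¹' argmax y c := by
  ext i
  simp [argmax, hf.forall]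

theorem argmax_add {x y : ι → E} {c : E} [Finite ι] [Nonempty ι] (h : argmax x c = argmax y c) :
    argmax (x + y) c = argmax x c := by
  ext i
  refine ⟨fun hi => ?_, fun hi j => ?_⟩
  · obtain ⟨k, hk⟩ := argmax_nonempty x c
    have h1 := hi k
    have h2 := (h ▸ hk : k ∈ argmax y c) i
    simp only [Pi.add_apply, inner_add_right] at h1
    refine mem_argmax_of_inner_eq hk (le_antisymm (hk i) ?_)
    linarith
  · have h1 := hi j
    have h2 := (h ▸ hi : i ∈ argmax y c) j
    simp only [Pi.add_apply, inner_add_right]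
    linarith

/-- A strict inequality that excludes `i` at `c` persists near `c`, so faces can only shrink under
small perturbations. -/
theorem eventually_argmax_subset [Finite ι] (x : ι → E) (c : E) :
    ∀ᶠ c' in 𝓝 c, argmax x c' ⊆ argmax x c := by
  have key : ∀ i, ∀ᶠ c' in 𝓝 c, i ∈ argmax x c' → i ∈ argmax x c := by
    intro i
    by_cases hi : i ∈ argmax x c
    · exact Eventually.of_forall fun _ _ => hi
    · simp only [argmax, Set.mem_ofPred_eq, not_forall, not_le] at hi
      obtain ⟨j, hj⟩ := hi
      have : ∀ᶠ c' in 𝓝 c, ⟪c', x i⟫ < ⟪c', x j⟫ :=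
        (ContinuousAt.eventually_lt (by fun_prop) (by fun_prop) hj)
      filter_upwards [this] with c' hc' h
      exact absurd (h j) (not_le.2 hc')
  filter_upwards [eventually_all.2 key] with c' h i hi using h i hi

theorem eventually_argmax_eq_singleton [Finite ι] [Nonempty ι] {x : ι → E} {c : E} {i : ι}
    (h : argmax x c = {i}) : ∀ᶠ c' in 𝓝 c, argmax x c' = {i} := by
  filter_upwards [eventually_argmax_subset x c] with c' hc'
  rw [h] at hc'
  exact (Set.Nonempty.subset_singleton_iff (argmax_nonempty x c')).1 hc'

theorem argmax_add_smul_eq_singleton {x : ι → E} {c d : E} {i : ι} (hc : i ∈ argmax x c)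
    (hd : argmax x d = {i}) {a b : ℝ} (ha : 0 ≤ a) (hb : 0 < b) :
    argmax x (a • c + b • d) = {i} := by
  have hdi : i ∈ argmax x d := hd ▸ rfl
  refine Set.eq_singleton_iff_unique_mem.2 ⟨fun j => ?_, fun j hj => ?_⟩
  · simp only [inner_add_left, real_inner_smul_left]
    exact add_le_add (mul_le_mul_of_nonneg_left (hc j) ha)
      (mul_le_mul_of_nonneg_left (hdi j) hb.le)
  · have h1 := hj i
    simp only [inner_add_left, real_inner_smul_left] at h1
    have h2 := mul_le_mul_of_nonneg_left (hc j) ha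
    have h3 : ⟪d, x i⟫ ≤ ⟪d, x j⟫ := le_of_mul_le_mul_left (by linarith) hb
    have h4 : j ∈ argmax x d := fun k => (hdi k).trans h3
    rwa [hd] at h4

/-- The normal cone of `i` is recovered from the directions in which `i` is the unique maximizer, by
pushing `c` towards such a direction `d` and letting the push tend to zero. Hence data about unique
maximizers determine every `argmax`. -/
theorem mem_argmax_iff_forall_pos {x : ι → E} {c d : E} {i : ι} (hd : argmax x d = {i}) :
    i ∈ argmax x c ↔ ∀ ε : ℝ, 0 < ε → argmax x ((1 : ℝ) • c + ε • d) = {i} := by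
  refine ⟨fun h ε hε => argmax_add_smul_eq_singleton h hd zero_le_one hε, fun h j => ?_⟩
  have hlim : ∀ k, Tendsto (fun ε : ℝ => ⟪(1 : ℝ) • c + ε • d, x k⟫) (𝓝[>] 0) (𝓝 ⟪c, x k⟫) := by
    intro k
    have : Continuous fun ε : ℝ => ⟪(1 : ℝ) • c + ε • d, x k⟫ := by fun_prop
    simpa using (this.tendsto 0).mono_left nhdsWithin_le_nhds
  refine le_of_tendsto_of_tendsto (hlim j) (hlim i) ?_
  filter_upwards [self_mem_nhdsWithin] with ε hε
  exact (h ε hε ▸ rfl : i ∈ argmax x ((1 : ℝ) • c + ε • d)) j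

/-- A function of the index that is constant on the maximizers at each point of a connected path
of directions is constant along the path. -/
theorem apply_eq_of_mem_argmax_path [Finite ι] [Nonempty ι] {X α : Type*} [TopologicalSpace X]
    [PreconnectedSpace X] {x : ι → E} {γ : X → E} (hγ : Continuous γ) {g : ι → α}
    (hg : ∀ t, ∀ a ∈ argmax x (γ t), ∀ b ∈ argmax x (γ t), g a = g b)
    {s t : X} {a b : ι} (ha : a ∈ argmax x (γ s)) (hb : b ∈ argmax x (γ t)) : g a = g b := by
  choose p hp using fun t => argmax_nonempty x (γ t)
  have hlc : IsLocallyConstant fun t => g (p t) := by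
    rw [IsLocallyConstant.iff_eventually_eq]
    intro t
    filter_upwards [hγ.continuousAt.eventually (eventually_argmax_subset x (γ t))] with s hs
    exact hg t _ (hs (hp s)) _ (hp t)
  rw [hg s a ha _ (hp s), hg t b hb _ (hp t)]
  exact hlc.apply_eq_of_preconnectedSpace s t

theorem eq_of_argmax_subsingleton_segment [Finite ι] [Nonempty ι] {x : ι → E} {c d : E}
    (h : ∀ t ∈ Set.Icc (0 : ℝ) 1, (argmax x ((1 - t) • c + t • d)).Subsingleton)
    {i j : ι} (hi : i ∈ argmax x c) (hj : j ∈ argmax x d) : i = j := by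
  have hγ : Continuous fun t : unitInterval => (1 - (t : ℝ)) • c + (t : ℝ) • d := by fun_prop
  exact apply_eq_of_mem_argmax_path (g := id) (s := 0) (t := 1) hγ
    (fun t a ha b hb => h t t.2 ha hb) (by simpa using hi) (by simpa using hj)

theorem argmax_segment_eq_singleton {x : ι → E} {c d : E} {i : ι} (hc : argmax x c = {i})
    (hd : argmax x d = {i}) {t : ℝ} (ht : t ∈ Set.Icc (0 : ℝ) 1) :
    argmax x ((1 - t) • c + t • d) = {i} := by
  rcases ht.1.eq_or_lt with rfl | h
  · simpa using hc
  · exact argmax_add_smul_eq_singleton (hc ▸ rfl) hd (by linarith [ht.2]) h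

/-- Two families of points, each of which is the unique maximizer of some linear function, agree in
their maximizers up to a bijection of the indices as soon as the directions with a unique maximizer
are the same. -/
theorem exists_bijective_argmax_comp_eq [Finite ι] [Nonempty ι] [Finite κ] [Nonempty κ]
    {x : ι → E} {y : κ → E} (hx : ∀ i, ∃ c, argmax x c = {i}) (hy : ∀ k, ∃ c, argmax y c = {k})
    (h : ∀ c, (argmax x c).Subsingleton ↔ (argmax y c).Subsingleton) :
    ∃ f : ι → κ, f.Bijective ∧ ∀ c, argmax (y ∘ f) c = argmax x c := by
  have sing : ∀ {c k}, (argmax y c).Subsingleton → k ∈ argmax y c → argmax y c = {k} :=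
    fun hs hk => Set.eq_singleton_iff_unique_mem.2 ⟨hk, fun j hj => hs hj hk⟩
  choose c hc using hx
  have hex : ∀ i, ∃ k, argmax y (c i) = {k} := fun i => by
    obtain ⟨k, hk⟩ := argmax_nonempty y (c i)
    exact ⟨k, sing ((h _).1 (by simp [hc i])) hk⟩
  choose f hf using hex
  -- If `f i = f k`, then `y` has a unique maximizer along the whole segment from `c i` to `c k`. So
  -- `x` has one too, and it cannot jump.
  have hinj : f.Injective := by
    intro i k hik
    refine eq_of_argmax_subsingleton_segment (x := x) (c := c i) (d := c k) (fun t ht => ?_)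
      (by simp [hc]) (by simp [hc])
    rw [h, argmax_segment_eq_singleton (hf i) (hik ▸ hf k) ht]
    exact Set.subsingleton_singleton
  have hA : ∀ {d i}, argmax x d = {i} → argmax y d = {f i} := by
    intro d i hd
    obtain ⟨k, hk⟩ := argmax_nonempty y d
    have hs : (argmax y d).Subsingleton := (h d).1 (by simp [hd])
    have : k = f i := by
      refine eq_of_argmax_subsingleton_segment (x := y) (c := d) (d := c i) (fun t ht => ?_)
        hk (by simp [hf])
      rw [← h, argmax_segment_eq_singleton hd (hc i) ht]
      exact Set.subsingleton_singleton
    exact this ▸ sing hs hk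
  have hB : ∀ {d i}, argmax y d = {f i} → argmax x d = {i} := by
    intro d i hd
    obtain ⟨k, hk⟩ := argmax_nonempty x d
    have hs : (argmax x d).Subsingleton := (h d).2 (by simp [hd])
    have hk' : argmax x d = {k} :=
      Set.eq_singleton_iff_unique_mem.2 ⟨hk, fun j hj => hs hj hk⟩
    rw [hk', hinj (Set.singleton_injective ((hA hk').symm.trans hd))]
  have hsurj : f.Surjective := by
    intro k
    obtain ⟨d, hd⟩ := hy k
    obtain ⟨i, hi⟩ := argmax_nonempty x d
    have hs : (argmax x d).Subsingleton := (h d).2 (by simp [hd])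
    refine ⟨i, Set.singleton_injective ((hA ?_).symm.trans hd)⟩
    exact Set.eq_singleton_iff_unique_mem.2 ⟨hi, fun j hj => hs hj hi⟩
  refine ⟨f, ⟨hinj, hsurj⟩, fun d => ?_⟩
  rw [argmax_comp_surjective hsurj]
  ext i
  rw [Set.mem_preimage, mem_argmax_iff_forall_pos (hf i), mem_argmax_iff_forall_pos (hc i)]
  exact forall₂_congr fun ε _ => ⟨hB, hA⟩

/-- Dually: if `u` is orthogonal to the face of `v` at `c`, a small tilt of `c` by `u` keeps that
face maximal. The maximizers of `x` are the same, so `u` is constant on the face of `x` as well. -/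
theorem vectorSpan_image_argmax_le [Finite ι] [Nonempty ι] [FiniteDimensional ℝ E] {x v : ι → E}
    (h : ∀ c, argmax x c = argmax v c) (c : E) :
    vectorSpan ℝ (x '' argmax v c) ≤ vectorSpan ℝ (v '' argmax v c) := by
  rw [← Submodule.orthogonal_orthogonal (vectorSpan ℝ (v '' argmax v c)), vectorSpan_def,
    Submodule.span_le]
  rintro _ ⟨_, ⟨i, hi, rfl⟩, _, ⟨j, hj, rfl⟩, rfl⟩
  rw [SetLike.mem_coe, Submodule.mem_orthogonal]
  intro u hu
  rw [Submodule.mem_orthogonal] at hu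
  have hv : ∀ a ∈ argmax v c, ∀ b ∈ argmax v c, ⟪u, v a⟫ = ⟪u, v b⟫ := by
    intro a ha b hb
    have := hu _ (vsub_mem_vectorSpan ℝ (Set.mem_image_of_mem v ha) (Set.mem_image_of_mem v hb))
    rw [real_inner_comm, vsub_eq_sub, inner_sub_right] at this
    linarith
  have hγ : Continuous fun ε : ℝ => c + ε • u := by fun_prop
  have hev : ∀ᶠ ε in 𝓝[>] (0 : ℝ), argmax v (c + ε • u) ⊆ argmax v c := by
    have h0 : Tendsto (fun ε : ℝ => c + ε • u) (𝓝[>] 0) (𝓝 c) := by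
      simpa using (hγ.tendsto 0).mono_left nhdsWithin_le_nhds
    exact h0.eventually (eventually_argmax_subset v c)
  obtain ⟨ε, hε, hpos⟩ := (hev.and self_mem_nhdsWithin).exists
  obtain ⟨k, hk⟩ := argmax_nonempty v (c + ε • u)
  have hmem : ∀ a ∈ argmax v c, a ∈ argmax v (c + ε • u) := by
    intro a ha
    refine mem_argmax_of_inner_eq hk ?_
    simp only [inner_add_left, real_inner_smul_left]
    rw [inner_eq_of_mem_argmax ha (hε hk), hv a ha k (hε hk)]
  have h1 := inner_eq_of_mem_argmax (h (c + ε • u) ▸ hmem i hi) (h (c + ε • u) ▸ hmem j hj)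
  have h2 := inner_eq_of_mem_argmax (h c ▸ hi : i ∈ argmax x c) (h c ▸ hj)
  simp only [inner_add_left, real_inner_smul_left] at h1
  have h3 : ε * ⟪u, x i⟫ = ε * ⟪u, x j⟫ := by linarith
  change ⟪u, x i - x j⟫ = 0
  rw [inner_sub_right, mul_left_cancel₀ (ne_of_gt hpos) h3, sub_self]

/-! ### Generic directions and connectedness of the edge graph -/

theorem exists_mem_forall_inner_ne_zero [FiniteDimensional ℝ E] {κ : Type*} [Finite κ]
    {U : Set E} (hU : IsOpen U) (hne : U.Nonempty) (w : κ → E) :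
    ∃ c ∈ U, ∀ k, w k ≠ 0 → ⟪c, w k⟫ ≠ 0 := by
  have : Dense (⋂ k, {c : E | w k ≠ 0 → ⟪c, w k⟫ ≠ 0}) := by
    have := FiniteDimensional.complete ℝ E
    refine dense_iInter_of_isOpen (fun k => ?_) (fun k => ?_)
    · by_cases hk : w k = 0
      · simp [hk]
      · simp only [ne_eq, hk, not_false_eq_true, forall_const]
        exact isOpen_ne_fun (by fun_prop) (by fun_prop)
    · by_cases hk : w k = 0
      · simp [hk]
      · have h1 : interior (((ℝ ∙ w k)ᗮ : Submodule ℝ E) : Set E) = ∅ := by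
          by_contra hcon
          have h2 := Submodule.eq_top_of_nonempty_interior' _ (Set.nonempty_iff_ne_empty.2 hcon)
          have h3 : w k ∈ (ℝ ∙ w k)ᗮ := h2 ▸ Submodule.mem_top
          exact hk (inner_self_eq_zero.1 (Submodule.mem_orthogonal_singleton_iff_inner_right.1 h3))
        rw [interior_eq_empty_iff_dense_compl] at h1
        refine h1.mono fun c (hc : c ∉ (ℝ ∙ w k)ᗮ) _ h0 => hc ?_
        exact Submodule.mem_orthogonal_singleton_iff_inner_left.2 h0
  obtain ⟨c, hcU, hc⟩ := this.inter_open_nonempty U hU hne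
  exact ⟨c, hcU, fun k => Set.mem_iInter.1 hc k⟩

/-- The maximizers in direction `c` lie on a line. -/
def IsCollinearArgmax (v : ι → E) (c : E) : Prop :=
  ∃ u, ∀ a ∈ argmax v c, ∀ b ∈ argmax v c, v a - v b ∈ ℝ ∙ u

/-- The edge graph of a polytope is connected: a function of the vertices that is constant along
edges is constant. -/
theorem apply_eq_of_forall_isCollinearArgmax [Finite ι] [Nonempty ι] [FiniteDimensional ℝ E]
    {v : ι → E} (hv : ∀ i, ∃ c, argmax v c = {i}) {α : Type*} {g : ι → α}
    (hg : ∀ c, IsCollinearArgmax v c → ∀ a ∈ argmax v c, ∀ b ∈ argmax v c, g a = g b)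
    (i j : ι) : g i = g j := by
  have key : ∀ i, ∃ U : Set E, IsOpen U ∧ U.Nonempty ∧ ∀ c ∈ U, argmax v c = {i} := by
    intro i
    obtain ⟨c, hc⟩ := hv i
    obtain ⟨U, hU, hUo, hcU⟩ := eventually_nhds_iff.1 (eventually_argmax_eq_singleton hc)
    exact ⟨U, hUo, ⟨c, hcU⟩, hU⟩
  obtain ⟨U, hU, hUne, hUi⟩ := key i
  obtain ⟨V, hV, hVne, hVj⟩ := key j
  obtain ⟨c, hcU, hc⟩ := exists_mem_forall_inner_ne_zero hU hUne
    (fun p : ι × ι => v p.1 - v p.2)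
  -- These vectors are orthogonal to `c`. If two pairs of points are tied at the same direction on
  -- the line through `c` and `d`, then `d` is orthogonal to the corresponding vector too.
  -- Genericity of `d` makes that vector zero, so the two differences are parallel: the line meets
  -- only vertices and edges.
  obtain ⟨d, hdV, hd⟩ := exists_mem_forall_inner_ne_zero hV hVne
    (fun p : (ι × ι) × (ι × ι) => ⟪c, v p.2.1 - v p.2.2⟫ • (v p.1.1 - v p.1.2) -
      ⟪c, v p.1.1 - v p.1.2⟫ • (v p.2.1 - v p.2.2))
  have hγ : Continuous fun t : ℝ => (1 - t) • c + t • d := by fun_prop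
  refine apply_eq_of_mem_argmax_path (x := v) (s := 0) (t := 1) hγ (fun t => hg _ ?_)
    (by simp [hUi c hcU]) (by simp [hVj d hdV])
  by_cases hne : ∃ a ∈ argmax v ((1 - t) • c + t • d), ∃ b ∈ argmax v ((1 - t) • c + t • d),
      v a - v b ≠ 0
  · obtain ⟨a, ha, b, hb, hab⟩ := hne
    refine ⟨v a - v b, fun a' ha' b' hb' => ?_⟩
    have h1 := inner_eq_of_mem_argmax ha hb
    have h2 := inner_eq_of_mem_argmax ha' hb'
    have hp := hc (a, b) hab
    have hz := hd ((a, b), (a', b'))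
    simp only [ne_eq, not_imp_not, inner_sub_right, inner_smul_right] at hp hz
    simp only [inner_add_left, real_inner_smul_left] at h1 h2
    set p := ⟪c, v a⟫ - ⟪c, v b⟫ with hpdef
    set q := ⟪c, v a'⟫ - ⟪c, v b'⟫ with hqdef
    set p' := ⟪d, v a⟫ - ⟪d, v b⟫ with hpdef'
    set q' := ⟪d, v a'⟫ - ⟪d, v b'⟫ with hqdef'
    have e1 : (1 - t) * p + t * p' = 0 := by rw [hpdef, hpdef']; linarith
    have e2 : (1 - t) * q + t * q' = 0 := by rw [hqdef, hqdef']; linarith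
    -- At `t = 0` the direction is `c`, which was chosen to separate distinct points.
    have ht : t ≠ 0 := by
      rintro rfl
      apply hp
      linarith
    have h0 : q * p' - p * q' = 0 := by
      have : t * (q * p' - p * q') = 0 := by linear_combination q * e1 - p * e2
      exact (mul_eq_zero.1 this).resolve_left ht
    have h3 := sub_eq_zero.1 (hz h0)
    rw [Submodule.mem_span_singleton]
    refine ⟨p⁻¹ * q, ?_⟩
    rw [mul_smul, h3, smul_smul, inv_mul_cancel₀ hp, one_smul]
  · push Not at hne
    exact ⟨0, fun a ha b hb => by simp [hne a ha b hb]⟩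

end Argmax

/-! ### Finitely generated and open polyhedral cones -/

section Cone

open scoped NNReal

variable {V W : Type*} [AddCommGroup V] [Module ℝ V] [AddCommGroup W] [Module ℝ W]

theorem smul_mem_span_nnreal {S : Set V} {x : V} (hx : x ∈ Submodule.span ℝ≥0 S) {r : ℝ}
    (hr : 0 ≤ r) : r • x ∈ Submodule.span ℝ≥0 S := by
  lift r to ℝ≥0 using hr
  exact Submodule.smul_mem _ r hx

/-- One step of Fourier-Motzkin elimination: the intersection of a finitely generated cone with a
half-space is finitely generated. -/
theorem exists_finset_span_inf_halfspace (S : Finset V) (f : V →ₗ[ℝ] ℝ) :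
    ∃ T : Finset V, ∀ x, x ∈ Submodule.span ℝ≥0 (T : Set V) ↔
      x ∈ Submodule.span ℝ≥0 (S : Set V) ∧ 0 ≤ f x := by
  classical
  have fsmul : ∀ (r : ℝ≥0) (x : V), f (r • x) = r * f x := fun r x => by
    rw [NNReal.smul_def, map_smul, smul_eq_mul]
  -- Keep the generators on the nonnegative side, and for each pair on opposite strict sides add the
  -- positive combination on which `f` vanishes.
  let T : Finset V := S.filter (fun s => 0 ≤ f s) ∪
    ((S.filter (fun s => 0 < f s) ×ˢ S.filter (fun s => f s < 0)).image
      fun p => f p.1 • p.2 - f p.2 • p.1)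
  have hT1 : ∀ s ∈ S, 0 ≤ f s → s ∈ Submodule.span ℝ≥0 (T : Set V) := fun s hs h =>
    Submodule.subset_span (by simp [T, hs, h])
  have hT2 : ∀ s ∈ S, ∀ t ∈ S, 0 < f s → f t < 0 →
      f s • t - f t • s ∈ Submodule.span ℝ≥0 (T : Set V) := fun s hs t ht h h' =>
    Submodule.subset_span (by
      simp only [T, Finset.coe_union, Finset.coe_image, Set.mem_union, Set.mem_image]
      exact Or.inr ⟨(s, t), by simp [hs, ht, h, h'], rfl⟩)
  have hnn : ∀ x ∈ Submodule.span ℝ≥0 (T : Set V), 0 ≤ f x := by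
    intro x hx
    induction hx using Submodule.span_induction with
    | mem x hx =>
      simp only [T, Finset.coe_union, Finset.coe_image, Set.mem_union, Set.mem_image,
        Finset.mem_coe, Finset.mem_filter, Finset.mem_product] at hx
      rcases hx with ⟨-, h⟩ | ⟨⟨s, t⟩, -, rfl⟩
      · exact h
      · simp [mul_comm]
    | zero => simp
    | add x y _ _ hx hy => rw [map_add]; exact add_nonneg hx hy
    | smul r x _ hx => rw [fsmul]; exact mul_nonneg r.2 hx
  -- adding a multiple of a generator on the negative side
  have hneg : ∀ t ∈ S, f t < 0 → ∀ p ∈ Submodule.span ℝ≥0 (T : Set V), ∀ μ : ℝ≥0,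
      0 ≤ f p + μ * f t → p + μ • t ∈ Submodule.span ℝ≥0 (T : Set V) := by
    intro t ht hft p hp
    have main : ∀ s ∈ S, 0 ≤ f s → ∀ μ : ℝ≥0,
        0 ≤ f s + μ * f t → s + μ • t ∈ Submodule.span ℝ≥0 (T : Set V) := by
      intro s hs hfs μ hμ
      rcases hfs.eq_or_lt with h0 | hpos
      · have : μ = 0 := by
          have : (μ : ℝ) ≤ 0 := by
            by_contra! hc
            nlinarith [mul_neg_of_pos_of_neg hc hft]
          exact le_antisymm (by exact_mod_cast this) zero_le
        simpa [this] using hT1 s hs hfs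
      · have hθ : 0 ≤ 1 + μ * f t / f s := by
          have : 1 + μ * f t / f s = (f s + μ * f t) / f s := by field_simp
          rw [this]
          exact div_nonneg hμ hpos.le
        have e : s + μ • t = (1 + μ * f t / f s) • s + (μ / f s) • (f s • t - f t • s) := by
          rw [NNReal.smul_def]
          match_scalars <;> field_simp
          ring
        rw [e]
        exact add_mem (smul_mem_span_nnreal (hT1 s hs hfs) hθ)
          (smul_mem_span_nnreal (hT2 s hs t ht hpos hft) (div_nonneg μ.2 hpos.le))
    induction hp using Submodule.span_induction with
    | mem x hx =>
      intro μ hμ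
      by_cases hxS : x ∈ S ∧ 0 ≤ f x
      · exact main x hxS.1 hxS.2 μ hμ
      · have hx0 : f x = 0 := by
          simp only [T, Finset.coe_union, Finset.coe_image, Set.mem_union, Set.mem_image,
            Finset.mem_coe, Finset.mem_filter, Finset.mem_product] at hx
          rcases hx with h | ⟨⟨s, t⟩, -, rfl⟩
          · exact absurd h hxS
          · simp [mul_comm]
        have : (μ : ℝ) ≤ 0 := by
          by_contra! hc
          nlinarith [mul_neg_of_pos_of_neg hc hft]
        have : μ = 0 := le_antisymm (by exact_mod_cast this) zero_le
        simpa [this] using Submodule.subset_span hx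
    | zero =>
      intro μ hμ
      have : (μ : ℝ) ≤ 0 := by
        by_contra! hc
        rw [map_zero] at hμ
        nlinarith [mul_neg_of_pos_of_neg hc hft]
      have : μ = 0 := le_antisymm (by exact_mod_cast this) zero_le
      simp [this]
    | add x y hx hy ihx ihy =>
      intro μ hμ
      have hfx := hnn x hx
      have hfy := hnn y hy
      rw [map_add] at hμ
      -- `a` is the multiple of `t` that brings `f x` down to zero. `x` absorbs up to that much, and
      -- `y` absorbs the rest.
      let a : ℝ≥0 := ⟨f x / (-f t), div_nonneg hfx (by linarith)⟩
      have ha : (a : ℝ) * f t = - f x := by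
        change f x / (-f t) * f t = - f x
        rw [div_neg, neg_mul, div_mul_cancel₀ _ hft.ne]
      rcases le_total μ a with h | h
      · have h1 : x + μ • t ∈ Submodule.span ℝ≥0 (T : Set V) := by
          refine ihx μ ?_
          have : (μ : ℝ) ≤ a := h
          nlinarith
        rw [show x + y + μ • t = (x + μ • t) + y by abel]
        exact add_mem h1 hy
      · have h1 : x + a • t ∈ Submodule.span ℝ≥0 (T : Set V) := ihx a (by linarith)
        have h2 : y + (μ - a) • t ∈ Submodule.span ℝ≥0 (T : Set V) := by
          refine ihy _ ?_
          rw [NNReal.coe_sub h]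
          linarith
        have e : x + y + μ • t = (x + a • t) + (y + (μ - a) • t) := by
          conv_lhs => rw [← add_tsub_cancel_of_le h, add_smul]
          abel
        rw [e]
        exact add_mem h1 h2
    | smul r x hx ih =>
      intro μ hμ
      rcases eq_or_ne r 0 with rfl | hr
      · have : (μ : ℝ) ≤ 0 := by
          by_contra! hc
          rw [zero_smul, map_zero] at hμ
          nlinarith [mul_neg_of_pos_of_neg hc hft]
        have : μ = 0 := le_antisymm (by exact_mod_cast this) zero_le
        simp [this]
      · have e : r • x + μ • t = r • (x + (r⁻¹ * μ) • t) := by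
          rw [smul_add, smul_smul, mul_inv_cancel_left₀ hr]
        rw [e]
        refine Submodule.smul_mem _ _ (ih _ ?_)
        have hr' : 0 < (r : ℝ) := by exact_mod_cast pos_iff_ne_zero.2 hr
        rw [fsmul] at hμ
        push_cast
        have : f x + (r : ℝ)⁻¹ * μ * f t = (r : ℝ)⁻¹ * (r * f x + μ * f t) := by
          field_simp
        rw [this]
        positivity
  -- The offset `p` makes the induction work: for a sum `x + y`, the two terms are added to `p` in
  -- an order that keeps `f` nonnegative at the intermediate point.
  have hstep : ∀ x ∈ Submodule.span ℝ≥0 (S : Set V), ∀ p ∈ Submodule.span ℝ≥0 (T : Set V),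
      0 ≤ f (p + x) → p + x ∈ Submodule.span ℝ≥0 (T : Set V) := by
    intro x hx
    induction hx using Submodule.span_induction with
    | mem x hx =>
      intro p hp h
      rcases le_or_gt 0 (f x) with h0 | h0
      · exact add_mem hp (hT1 x hx h0)
      · simpa using hneg x hx h0 p hp 1 (by simpa using h)
    | zero => intro p hp _; simpa using hp
    | add x y _ _ ihx ihy =>
      intro p hp h
      have hfp := hnn p hp
      rcases le_or_gt 0 (f (p + x)) with h0 | h0
      · rw [← add_assoc] at h ⊢
        exact ihy _ (ihx p hp h0) h
      · have e : p + (x + y) = (p + y) + x := by abel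
        rw [e] at h ⊢
        refine ihx _ (ihy p hp ?_) h
        simp only [map_add] at h h0 ⊢
        linarith
    | smul r x _ ih =>
      intro p hp h
      rcases eq_or_ne r 0 with rfl | hr
      · simpa using hp
      · have e : p + r • x = r • (r⁻¹ • p + x) := by
          rw [smul_add, smul_smul, mul_inv_cancel₀ hr, one_smul]
        rw [e] at h ⊢
        refine Submodule.smul_mem _ _ (ih _ (Submodule.smul_mem _ _ hp) ?_)
        rw [fsmul] at h
        exact nonneg_of_mul_nonneg_right h (by exact_mod_cast pos_iff_ne_zero.2 hr)
  refine ⟨T, fun x => ⟨fun hx => ⟨?_, hnn x hx⟩, fun ⟨hx, h⟩ => ?_⟩⟩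
  · refine (Submodule.span_le.2 ?_ : Submodule.span ℝ≥0 (T : Set V) ≤ _) hx
    intro y hy
    simp only [T, Finset.coe_union, Finset.coe_image, Set.mem_union, Set.mem_image,
      Finset.mem_coe, Finset.mem_filter, Finset.mem_product] at hy
    rcases hy with h | ⟨⟨s, t⟩, ⟨⟨hs, hfs⟩, ht, hft⟩, rfl⟩
    · exact Submodule.subset_span h.1
    · rw [sub_eq_add_neg, ← neg_smul]
      exact add_mem (smul_mem_span_nnreal (Submodule.subset_span ht) hfs.le)
        (smul_mem_span_nnreal (Submodule.subset_span hs) (neg_nonneg.2 hft.le))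
  · simpa using hstep x hx 0 (zero_mem _) (by simpa using h)

theorem exists_finset_span_nnreal_eq_top [FiniteDimensional ℝ V] :
    ∃ S : Finset V, Submodule.span ℝ≥0 (S : Set V) = ⊤ := by
  classical
  let b := Module.finBasis ℝ V
  refine ⟨Finset.univ.image b ∪ Finset.univ.image (fun i => -b i), ?_⟩
  rw [eq_top_iff]
  intro x _
  rw [← b.sum_repr x]
  refine sum_mem fun i _ => ?_
  rcases le_total 0 (b.repr x i) with h | h
  · exact smul_mem_span_nnreal (Submodule.subset_span (by simp)) h
  · rw [← neg_smul_neg]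
    exact smul_mem_span_nnreal (Submodule.subset_span (by simp)) (neg_nonneg.2 h)

/-- A polyhedral cone is finitely generated. -/
theorem exists_finset_mem_span_iff_forall_nonneg [FiniteDimensional ℝ V] {κ : Type*}
    (s : Finset κ) (f : κ → V →ₗ[ℝ] ℝ) :
    ∃ T : Finset V, ∀ x, x ∈ Submodule.span ℝ≥0 (T : Set V) ↔ ∀ k ∈ s, 0 ≤ f k x := by
  classical
  induction s using Finset.induction_on with
  | empty =>
    obtain ⟨S, hS⟩ := exists_finset_span_nnreal_eq_top (V := V)
    exact ⟨S, fun x => by simp [hS]⟩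
  | insert k s _ ih =>
    obtain ⟨S, hS⟩ := ih
    obtain ⟨T, hT⟩ := exists_finset_span_inf_halfspace S (f k)
    exact ⟨T, fun x => by rw [hT, hS, Finset.forall_mem_insert, and_comm]⟩

theorem IsOpenPolyhedralCone.inter_submodule {C : Set V} (hC : IsOpenPolyhedralCone C)
    (K : Submodule ℝ V) : IsOpenPolyhedralCone (C ∩ K) := by
  obtain ⟨L, A, rfl⟩ := hC
  refine ⟨L ⊓ K, A, ?_⟩
  ext x
  simp only [Set.mem_inter_iff, Set.mem_ofPred_eq, SetLike.mem_coe, Submodule.mem_inf]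
  tauto

/-- If a linear map has a linear retraction on a subspace, it maps open polyhedral cones in the
subspace to open polyhedral cones. -/
theorem IsOpenPolyhedralCone.image {C : Set V} (hC : IsOpenPolyhedralCone C) {K : Submodule ℝ V}
    (hCK : C ⊆ K) {e : V →ₗ[ℝ] W} {r : W →ₗ[ℝ] V} (hr : ∀ x ∈ K, r (e x) = x) :
    IsOpenPolyhedralCone (e '' C) := by
  classical
  obtain ⟨L, A, hLA⟩ := hC.inter_submodule K
  rw [Set.inter_eq_left.2 hCK] at hLA
  refine ⟨(L ⊓ K).map e, A.image fun f => f ∘ₗ r, ?_⟩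
  ext y
  simp only [Set.mem_image, Set.mem_ofPred_eq, Submodule.mem_map, Finset.forall_mem_image,
    LinearMap.comp_apply]
  constructor
  · rintro ⟨x, hx, rfl⟩
    have hxK := hCK hx
    rw [hLA] at hx
    exact ⟨⟨x, ⟨hx.1, hxK⟩, rfl⟩, fun f hf => by rw [hr x hxK]; exact hx.2 f hf⟩
  · rintro ⟨⟨x, ⟨hxL, hxK⟩, rfl⟩, hf⟩
    refine ⟨x, ?_, rfl⟩
    rw [hLA]
    exact ⟨hxL, fun f hfA => by simpa only [hr x hxK] using hf hfA⟩

end Cone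

/-! ### Families with prescribed maximizers and the linearized inscribed condition -/

section Families

variable {E : Type*} [NormedAddCommGroup E] [InnerProductSpace ℝ E] {ι : Type*}

/-- A convex combination attains the maximum only if every point of positive weight does. Points of
weight zero are replaced by `x i`. -/
theorem mem_convexHull_image_argmax {x : ι → E} {c y : E} {i : ι}
    (hy : y ∈ convexHull ℝ (Set.range x)) (hi : i ∈ argmax x c) (h : ⟪c, x i⟫ ≤ ⟪c, y⟫) :
    y ∈ convexHull ℝ (x '' argmax x c) := by
  classical
  obtain ⟨κ, _, w, z, hw, hw1, hz, rfl⟩ := mem_convexHull_iff_exists_fintype.1 hy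
  choose p hp using hz
  have hnn : ∀ k ∈ Finset.univ, 0 ≤ w k * (⟪c, x i⟫ - ⟪c, z k⟫) := fun k _ =>
    mul_nonneg (hw k) (sub_nonneg.2 (hp k ▸ hi (p k)))
  have hsum : ∑ k, w k * (⟪c, x i⟫ - ⟪c, z k⟫) = 0 := by
    refine le_antisymm ?_ (Finset.sum_nonneg hnn)
    simp only [inner_sum, inner_smul_right] at h
    simp only [mul_sub, Finset.sum_sub_distrib, ← Finset.sum_mul, hw1, one_mul]
    linarith
  have h0 := (Finset.sum_eq_zero_iff_of_nonneg hnn).1 hsum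
  refine mem_convexHull_of_exists_fintype w (fun k => if w k = 0 then x i else z k) hw hw1
    (fun k => ?_) (Finset.sum_congr rfl fun k _ => ?_)
  · split_ifs with hk
    · exact ⟨i, hi, rfl⟩
    · have := sub_eq_zero.1 ((mul_eq_zero.1 (h0 k (Finset.mem_univ k))).resolve_left hk)
      exact ⟨p k, mem_argmax_of_inner_eq hi (by rw [hp, this]), hp k⟩
  · split_ifs with hk
    · simp [hk]
    · rfl

theorem inner_le_of_mem_convexHull_range {x : ι → E} {c y : E} {i : ι}
    (hy : y ∈ convexHull ℝ (Set.range x)) (hi : i ∈ argmax x c) : ⟪c, y⟫ ≤ ⟪c, x i⟫ := by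
  have hc : Convex ℝ {y : E | ⟪c, y⟫ ≤ ⟪c, x i⟫} :=
    convex_halfSpace_le (innerₛₗ ℝ c).isLinear _
  exact convexHull_min (Set.range_subset_iff.2 fun j => hi j) hc hy

/-- A convex hull of finitely many points that has larger support function contains the set. -/
theorem subset_convexHull_range [FiniteDimensional ℝ E] [Finite ι] {x : ι → E} {K : Set E}
    (h : ∀ c, ∃ i, ∀ y ∈ K, ⟪c, y⟫ ≤ ⟪c, x i⟫) : K ⊆ convexHull ℝ (Set.range x) := by
  intro y hy
  by_contra hcon
  obtain ⟨f, u, h1, h2⟩ := geometric_hahn_banach_closed_point (convex_convexHull ℝ _)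
    ((Set.finite_range x).isCompact_convexHull ℝ).isClosed hcon
  have := FiniteDimensional.complete ℝ E
  obtain ⟨i, hi⟩ := h ((InnerProductSpace.toDual ℝ E).symm f)
  have h3 := hi y hy
  rw [InnerProductSpace.toDual_symm_apply, InnerProductSpace.toDual_symm_apply] at h3
  linarith [h1 (x i) (subset_convexHull ℝ _ (Set.mem_range_self i))]

theorem injective_of_exposed {x : ι → E} (hx : ∀ i, ∃ c, argmax x c = {i}) : x.Injective := by
  intro i j hij
  obtain ⟨c, hc⟩ := hx i
  have hi : i ∈ argmax x c := hc ▸ rfl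
  have hj : j ∈ argmax x c := mem_argmax_of_inner_eq hi (by rw [hij])
  rw [hc] at hj
  exact hj.symm

/-- The families for which the corresponding edges of the convex hulls are parallel and the edges
of the second one are seen from the origin under a right angle at their midpoints. -/
def inscribedSubmodule (v : ι → E) : Submodule ℝ (ι → E) where
  carrier := {x | (∀ i, x i ∈ vectorSpan ℝ (Set.range v)) ∧ ∀ c, IsCollinearArgmax v c →
    ∀ a ∈ argmax v c, ∀ b ∈ argmax v c, x a - x b ∈ ℝ ∙ (v a - v b) ∧
      ⟪x a + x b, v a - v b⟫ = 0}
  add_mem' := by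
    rintro x y ⟨hx, hx'⟩ ⟨hy, hy'⟩
    refine ⟨fun i => add_mem (hx i) (hy i), fun c hc a ha b hb => ?_⟩
    obtain ⟨h1, h2⟩ := hx' c hc a ha b hb
    obtain ⟨h3, h4⟩ := hy' c hc a ha b hb
    refine ⟨?_, ?_⟩
    · rw [Pi.add_apply, Pi.add_apply, add_sub_add_comm]
      exact add_mem h1 h3
    · rw [Pi.add_apply, Pi.add_apply, add_add_add_comm, inner_add_left, h2, h4, add_zero]
  zero_mem' := ⟨fun i => zero_mem _, fun c _ a _ b _ => by simp⟩
  smul_mem' := by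
    rintro t x ⟨hx, hx'⟩
    refine ⟨fun i => Submodule.smul_mem _ _ (hx i), fun c hc a ha b hb => ?_⟩
    obtain ⟨h1, h2⟩ := hx' c hc a ha b hb
    refine ⟨?_, ?_⟩
    · rw [Pi.smul_apply, Pi.smul_apply, ← smul_sub]
      exact Submodule.smul_mem _ _ h1
    · rw [Pi.smul_apply, Pi.smul_apply, ← smul_add, real_inner_smul_left, h2, mul_zero]

/-- The families in `inscribedSubmodule v` that have the same maximizers as `v`. -/
def inscribedFamilies (v : ι → E) : Set (ι → E) :=
  {x | ∀ c, argmax x c = argmax v c} ∩ inscribedSubmodule v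

theorem smul_mem_inscribedFamilies {v x : ι → E} (hx : x ∈ inscribedFamilies v) {t : ℝ}
    (ht : 0 < t) : t • x ∈ inscribedFamilies v :=
  ⟨fun c => by rw [argmax_smul x ht, hx.1 c], Submodule.smul_mem _ _ hx.2⟩

/-- Reusing the convex weights of a point of one hull on the other family moves it by at most `dist
x y`. -/
theorem hausdorffDist_convexHull_range_le [Fintype ι] (x y : ι → E) :
    Metric.hausdorffDist (convexHull ℝ (Set.range x)) (convexHull ℝ (Set.range y)) ≤ dist x y := by
  have key : ∀ x y : ι → E, ∀ p ∈ convexHull ℝ (Set.range x),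
      ∃ q ∈ convexHull ℝ (Set.range y), dist p q ≤ dist x y := by
    intro x y p hp
    obtain ⟨κ, _, w, z, hw, hw1, hz, rfl⟩ := mem_convexHull_iff_exists_fintype.1 hp
    choose k hk using hz
    refine ⟨∑ l, w l • y (k l), mem_convexHull_of_exists_fintype w (fun l => y (k l)) hw hw1
      (fun l => Set.mem_range_self _) rfl, ?_⟩
    rw [dist_eq_norm, ← Finset.sum_sub_distrib]
    calc ‖∑ l, (w l • z l - w l • y (k l))‖ ≤ ∑ l, ‖w l • z l - w l • y (k l)‖ := norm_sum_le _ _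
      _ ≤ ∑ l, w l * dist x y := by
        refine Finset.sum_le_sum fun l _ => ?_
        rw [← smul_sub, norm_smul, Real.norm_of_nonneg (hw l), ← hk l, ← dist_eq_norm]
        exact mul_le_mul_of_nonneg_left (dist_le_pi_dist x y (k l)) (hw l)
      _ = dist x y := by rw [← Finset.sum_mul, hw1, one_mul]
  exact Metric.hausdorffDist_le_of_mem_dist dist_nonneg (key x y)
    fun p hp => by simpa only [dist_comm x y] using key y x p hp

variable [Finite ι] [Nonempty ι]

theorem add_mem_inscribedFamilies {v x y : ι → E} (hx : x ∈ inscribedFamilies v)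
    (hy : y ∈ inscribedFamilies v) : x + y ∈ inscribedFamilies v :=
  ⟨fun c => by rw [argmax_add ((hx.1 c).trans (hy.1 c).symm), hx.1 c], add_mem hx.2 hy.2⟩

/-- The vertex that maximizes a given linear function, among all convex hulls with prescribed
maximizers, depends on the convex hull in a Lipschitz way with respect to the Hausdorff distance. -/
theorem exists_norm_sub_le_of_exposed {v : ι → E} {i : ι} (hi : ∃ c, argmax v c = {i}) :
    ∃ K : ℝ, ∀ x y : ι → E, (∀ c, argmax x c = argmax v c) → (∀ c, argmax y c = argmax v c) →
      ‖x i - y i‖ ≤ K * Metric.hausdorffDist (convexHull ℝ (Set.range x))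
        (convexHull ℝ (Set.range y)) := by
  obtain ⟨c, hc⟩ := hi
  obtain ⟨δ, hδ, hball⟩ := Metric.eventually_nhds_iff.1 (eventually_argmax_eq_singleton hc)
  have hcpt : ∀ x : ι → E, IsCompact (convexHull ℝ (Set.range x)) := fun x =>
    (Set.finite_range x).isCompact_convexHull ℝ
  have hne : ∀ x : ι → E, (convexHull ℝ (Set.range x)).Nonempty := fun x =>
    convexHull_nonempty_iff.2 (Set.range_nonempty x)
  -- Compare `x i` with its nearest point in the hull of `y`, on which `⟪d, ·⟫` is at most `⟪d, y
  -- i⟫`.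
  have hbd : ∀ x y : ι → E, ∀ d : E, i ∈ argmax y d → ⟪d, x i - y i⟫ ≤
      ‖d‖ * Metric.hausdorffDist (convexHull ℝ (Set.range x)) (convexHull ℝ (Set.range y)) := by
    intro x y d hd
    obtain ⟨z, hz, hdist⟩ := (hcpt y).exists_infDist_eq_dist (hne y) (x i)
    have h1 := Metric.infDist_le_hausdorffDist_of_mem
      (subset_convexHull ℝ _ (Set.mem_range_self i) : x i ∈ convexHull ℝ (Set.range x))
      (Metric.hausdorffEDist_ne_top_of_nonempty_of_bounded (hne x) (hne y) (hcpt x).isBounded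
        (hcpt y).isBounded)
    rw [hdist, dist_eq_norm] at h1
    have h2 := inner_le_of_mem_convexHull_range hz hd
    have h3 := (real_inner_le_norm d (x i - z)).trans
      (mul_le_mul_of_nonneg_left h1 (norm_nonneg d))
    rw [inner_sub_right] at h3 ⊢
    linarith
  -- Vertex `i` stays the unique maximizer at `c + u` with `u` of length `δ / 2` along `z = x i - y
  -- i`. Adding the bound at `c + u` to the reversed bound at `c` isolates `⟪u, z⟫ = δ / 2 * ‖z‖`.
  refine ⟨(2 / δ) * (2 * ‖c‖ + δ), fun x y hx hy => ?_⟩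
  set D := Metric.hausdorffDist (convexHull ℝ (Set.range x)) (convexHull ℝ (Set.range y)) with hD
  have hD0 : 0 ≤ D := Metric.hausdorffDist_nonneg
  set z := x i - y i with hz
  rcases eq_or_ne z 0 with h0 | h0
  · rw [h0, norm_zero]
    positivity
  have hzpos : 0 < ‖z‖ := norm_pos_iff.2 h0
  set u := (δ / 2 / ‖z‖) • z with hu
  have hunorm : ‖u‖ = δ / 2 := by
    rw [hu, norm_smul, Real.norm_of_nonneg (by positivity), div_mul_cancel₀ _ hzpos.ne']
  have h1 : ⟪c + u, z⟫ ≤ ‖c + u‖ * D := by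
    refine hbd x y _ ?_
    rw [hy, hball (y := c + u)]
    · exact rfl
    · rw [dist_eq_norm, add_sub_cancel_left, hunorm]
      linarith
  have h2 : -⟪c, z⟫ ≤ ‖c‖ * D := by
    have := hbd y x c (by rw [hx, hc]; exact rfl)
    rw [Metric.hausdorffDist_comm, ← hD, ← neg_sub (x i), ← hz, inner_neg_right] at this
    exact this
  have h3 : ⟪u, z⟫ = δ / 2 * ‖z‖ := by
    rw [hu, real_inner_smul_left, real_inner_self_eq_norm_sq]
    field_simp
  have h4 : ‖c + u‖ * D ≤ (‖c‖ + δ / 2) * D :=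
    mul_le_mul_of_nonneg_right ((norm_add_le c u).trans (by rw [hunorm])) hD0
  rw [inner_add_left, h3] at h1
  have h5 : δ / 2 * ‖z‖ ≤ (2 * ‖c‖ + δ) * D := by nlinarith
  calc ‖z‖ = 2 / δ * (δ / 2 * ‖z‖) := by field_simp
    _ ≤ 2 / δ * ((2 * ‖c‖ + δ) * D) := by gcongr
    _ = 2 / δ * (2 * ‖c‖ + δ) * D := by ring

variable [FiniteDimensional ℝ E]

/-- Along an edge, `x a - x b` is a multiple of `v a - v b`, hence orthogonal to `x a + x b`, which
means `‖x a‖ = ‖x b‖`. Connectedness of the edge graph does the rest. -/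
theorem norm_eq_of_mem_inscribedSubmodule {v x : ι → E} (hv : ∀ i, ∃ c, argmax v c = {i})
    (hx : x ∈ inscribedSubmodule v) (i j : ι) : ‖x i‖ = ‖x j‖ := by
  refine apply_eq_of_forall_isCollinearArgmax (g := fun i => ‖x i‖) hv (fun c hc a ha b hb => ?_)
    i j
  obtain ⟨h1, h2⟩ := hx.2 c hc a ha b hb
  obtain ⟨t, ht⟩ := Submodule.mem_span_singleton.1 h1
  rw [← real_inner_add_sub_eq_zero_iff, ← ht, inner_smul_right, h2, mul_zero]

/-- Equal maximizers force corresponding edges of `x` and `v` to be parallel, and the difference of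
`x` along an edge is nonzero, so the orthogonality passes from `x a - x b` to `v a - v b`. -/
theorem mem_inscribedSubmodule_of_norm_eq {v x : ι → E} (hv : ∀ i, ∃ c, argmax v c = {i})
    (hxv : ∀ c, argmax x c = argmax v c) (hspan : ∀ i, x i ∈ vectorSpan ℝ (Set.range v))
    (hnorm : ∀ i j, ‖x i‖ = ‖x j‖) : x ∈ inscribedSubmodule v := by
  refine ⟨hspan, fun c ⟨u, hu⟩ a ha b hb => ?_⟩
  rcases eq_or_ne a b with rfl | hab
  · simp
  have hxab : x a - x b ≠ 0 := sub_ne_zero.2 fun h =>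
    hab (injective_of_exposed (fun i => by simpa only [hxv] using hv i) h)
  have hvab : v a - v b ≠ 0 := sub_ne_zero.2 fun h => hab (injective_of_exposed hv h)
  have hxu : x a - x b ∈ ℝ ∙ u := by
    have h1 : vectorSpan ℝ (v '' argmax v c) ≤ ℝ ∙ u := by
      rw [vectorSpan_def, Submodule.span_le]
      rintro _ ⟨_, ⟨i, hi, rfl⟩, _, ⟨j, hj, rfl⟩, rfl⟩
      exact hu i hi j hj
    exact h1 (vectorSpan_image_argmax_le hxv c
      (vsub_mem_vectorSpan ℝ (Set.mem_image_of_mem x ha) (Set.mem_image_of_mem x hb)))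
  obtain ⟨s, hs⟩ := Submodule.mem_span_singleton.1 hxu
  obtain ⟨t, ht⟩ := Submodule.mem_span_singleton.1 (hu a ha b hb)
  have hs0 : s ≠ 0 := by
    rintro rfl
    exact hxab (by rw [← hs, zero_smul])
  have ht0 : t ≠ 0 := by
    rintro rfl
    exact hvab (by rw [← ht, zero_smul])
  have h0 : ⟪x a + x b, x a - x b⟫ = 0 := (real_inner_add_sub_eq_zero_iff _ _).2 (hnorm a b)
  rw [← hs, inner_smul_right] at h0
  refine ⟨Submodule.mem_span_singleton.2 ⟨s * t⁻¹, ?_⟩, ?_⟩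
  · rw [← ht, smul_smul, inv_mul_cancel_right₀ ht0, hs]
  · rw [← ht, inner_smul_right, (mul_eq_zero.1 h0).resolve_left hs0, mul_zero]

open scoped NNReal in
/-- Having the same maximizers as a given family is an open polyhedral condition. -/
theorem isOpenPolyhedralCone_argmax_eq (v : ι → E) :
    IsOpenPolyhedralCone {x : ι → E | ∀ c, argmax x c = argmax v c} := by
  classical
  have := Fintype.ofFinite ι
  have hgen : ∀ i, ∃ T : Finset E, ∀ c, c ∈ Submodule.span ℝ≥0 (T : Set E) ↔ i ∈ argmax v c := by
    intro i
    obtain ⟨T, hT⟩ := exists_finset_mem_span_iff_forall_nonneg Finset.univ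
      (fun k => innerₛₗ ℝ (v i - v k))
    refine ⟨T, fun c => ?_⟩
    rw [hT]
    simp [argmax, real_inner_comm]
  choose T hT using hgen
  let F : ι × E × ι → Module.Dual ℝ (ι → E) := fun p =>
    innerₛₗ ℝ p.2.1 ∘ₗ
      ((LinearMap.proj p.1 : (ι → E) →ₗ[ℝ] E) - (LinearMap.proj p.2.2 : (ι → E) →ₗ[ℝ] E))
  have hF : ∀ i g j x, F (i, g, j) x = ⟪g, x i⟫ - ⟪g, x j⟫ := fun i g j x => by
    simp [F, inner_sub_right]
  let I : Finset (ι × E × ι) := Finset.univ.biUnion fun i => {i} ×ˢ T i ×ˢ Finset.univ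
  have hI : ∀ i g j, (i, g, j) ∈ I ↔ g ∈ T i := fun i g j => by simp [I]
  -- The sign at `v` of each functional `F (i, g, j)`, with `g` a generator of the normal cone of
  -- `i`, is prescribed for `x`: zeros cut out the subspace, positive values give the strict
  -- inequalities.
  refine ⟨⨅ p ∈ I.filter (fun p => F p v = 0), LinearMap.ker (F p),
    (I.filter fun p => 0 < F p v).image F, ?_⟩
  ext x
  simp only [Set.mem_ofPred_eq, Submodule.mem_iInf, Finset.mem_filter, LinearMap.mem_ker,
    Finset.forall_mem_image, and_imp, Prod.forall, hI, hF]
  constructor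
  · intro h
    refine ⟨fun i g j hg h0 => ?_, fun i g j hg h0 => ?_⟩
    · have hi : i ∈ argmax v g := (hT i g).1 (Submodule.subset_span hg)
      have hj : j ∈ argmax v g := mem_argmax_of_inner_eq hi (sub_eq_zero.1 h0).symm
      rw [inner_eq_of_mem_argmax (h g ▸ hi : i ∈ argmax x g) (h g ▸ hj), sub_self]
    · have hi : i ∈ argmax v g := (hT i g).1 (Submodule.subset_span hg)
      have hi' : i ∈ argmax x g := h g ▸ hi
      by_contra! hcon
      have hj : j ∈ argmax x g :=
        mem_argmax_of_inner_eq hi' (le_antisymm (hi' j) (by linarith))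
      rw [h g] at hj
      linarith [hj i]
  · rintro ⟨h0, hpos⟩ c
    -- A sum of nonnegative terms vanishes only if each term does, so agreement of the zero sets
    -- passes from the generators to the whole normal cone.
    have key : ∀ i j, ∀ c ∈ Submodule.span ℝ≥0 (T i : Set E),
        0 ≤ ⟪c, v i⟫ - ⟪c, v j⟫ ∧ 0 ≤ ⟪c, x i⟫ - ⟪c, x j⟫ ∧
          (⟪c, x i⟫ - ⟪c, x j⟫ = 0 ↔ ⟪c, v i⟫ - ⟪c, v j⟫ = 0) := by
      intro i j c hc
      induction hc using Submodule.span_induction with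
      | mem g hg =>
        have h1 : 0 ≤ ⟪g, v i⟫ - ⟪g, v j⟫ :=
          sub_nonneg.2 ((hT i g).1 (Submodule.subset_span hg) j)
        rcases h1.eq_or_lt with h2 | h2
        · have := h0 i g j hg h2.symm
          simp [this, ← h2]
        · have := hpos i g j hg h2
          exact ⟨h1, this.le, by simp [this.ne', h2.ne']⟩
      | zero => simp
      | add c d _ _ hc hd =>
        obtain ⟨h1, h2, h3⟩ := hc
        obtain ⟨h4, h5, h6⟩ := hd
        simp only [inner_add_left, add_sub_add_comm]
        exact ⟨add_nonneg h1 h4, add_nonneg h2 h5, by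
          rw [add_eq_zero_iff_of_nonneg h1 h4, add_eq_zero_iff_of_nonneg h2 h5, h3, h6]⟩
      | smul r c _ hc =>
        obtain ⟨h1, h2, h3⟩ := hc
        simp only [NNReal.smul_def, real_inner_smul_left, ← mul_sub]
        exact ⟨mul_nonneg r.2 h1, mul_nonneg r.2 h2, by rw [mul_eq_zero, mul_eq_zero, h3]⟩
    have hle : argmax v c ⊆ argmax x c := fun i hi j =>
      sub_nonneg.1 (key i j c ((hT i c).2 hi)).2.1
    refine Set.Subset.antisymm (fun j hj => ?_) hle
    obtain ⟨i, hi⟩ := argmax_nonempty v c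
    have h1 : ⟪c, x i⟫ - ⟪c, x j⟫ = 0 := sub_eq_zero.2 (inner_eq_of_mem_argmax (hle hi) hj)
    exact mem_argmax_of_inner_eq hi
      (sub_eq_zero.1 ((key i j c ((hT i c).2 hi)).2.2.1 h1)).symm

theorem isOpenPolyhedralCone_inscribedFamilies (v : ι → E) :
    IsOpenPolyhedralCone (inscribedFamilies v) :=
  (isOpenPolyhedralCone_argmax_eq v).inter_submodule _

/-- All points of such a family have the norm of `x i`, so evaluation at `i` has trivial kernel on
the subspace. -/
theorem exists_linearMap_apply_eq {v : ι → E} (hv : ∀ i, ∃ c, argmax v c = {i}) (i : ι) :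
    ∃ r : E →ₗ[ℝ] ι → E, ∀ x ∈ inscribedSubmodule v, r (x i) = x := by
  have hker : LinearMap.ker ((LinearMap.proj i : (ι → E) →ₗ[ℝ] E) ∘ₗ
      (inscribedSubmodule v).subtype) = ⊥ := by
    rw [LinearMap.ker_eq_bot']
    rintro ⟨x, hx⟩ h0
    have h0 : x i = 0 := h0
    ext j
    have := norm_eq_of_mem_inscribedSubmodule hv hx j i
    simpa [h0] using this
  obtain ⟨r, hr⟩ := LinearMap.exists_leftInverse_of_injective _ hker
  refine ⟨(inscribedSubmodule v).subtype ∘ₗ r, fun x hx => ?_⟩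
  have := LinearMap.congr_fun hr ⟨x, hx⟩
  exact congrArg Subtype.val this

end Families

/-! ### Translation to polytopes and the inscribed cone -/

namespace Polytope

variable {n : ℕ}

theorem finite_vertices (P : Polytope n) : P.vertices.Finite := by
  obtain ⟨s, -, h⟩ := P.exists_finset
  rw [vertices, h]
  exact s.finite_toSet.subset extremePoints_convexHull_subset

theorem convexHull_vertices (P : Polytope n) : convexHull ℝ P.vertices = P.carrier := by
  rw [← closure_convexHull_extremePoints P.isCompact_carrier P.convex_carrier]
  exact (P.finite_vertices.isCompact_convexHull ℝ).isClosed.closure_eq.symm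

theorem nonempty_vertices (P : Polytope n) : P.vertices.Nonempty :=
  P.isCompact_carrier.extremePoints_nonempty P.nonempty_carrier

/-- A vertex is outside the convex hull of the other vertices; a separating functional exposes it.
-/
theorem exists_argmax_vertices_eq_singleton (P : Polytope n) (i : P.vertices) :
    ∃ c, argmax (Subtype.val : P.vertices → EuclideanSpace ℝ (Fin n)) c = {i} := by
  have hi : i.1 ∉ convexHull ℝ (P.vertices \ {i.1}) := fun h =>
    (P.convex_carrier.mem_extremePoints_iff_mem_sdiff_convexHull_sdiff.1 i.2).2
      (convexHull_mono (Set.sdiff_subset_sdiff_left extremePoints_subset) h)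
  obtain ⟨f, u, h1, h2⟩ := geometric_hahn_banach_closed_point (convex_convexHull ℝ _)
    ((P.finite_vertices.subset Set.sdiff_subset).isCompact_convexHull ℝ).isClosed hi
  have hlt : ∀ j : P.vertices, j ≠ i → f j.1 < f i.1 := fun j hj =>
    (h1 j.1 (subset_convexHull ℝ _ ⟨j.2, fun h => hj (Subtype.ext h)⟩)).trans h2
  refine ⟨(InnerProductSpace.toDual ℝ _).symm f, Set.eq_singleton_iff_unique_mem.2
    ⟨fun j => ?_, fun j hj => ?_⟩⟩
  · rw [InnerProductSpace.toDual_symm_apply, InnerProductSpace.toDual_symm_apply]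
    rcases eq_or_ne j i with rfl | h
    · exact le_rfl
    · exact (hlt j h).le
  · by_contra hne
    have := hj i
    rw [InnerProductSpace.toDual_symm_apply, InnerProductSpace.toDual_symm_apply] at this
    exact absurd (hlt j hne) (not_lt.2 this)

variable {ι : Type*}

theorem face_eq_convexHull_image [Finite ι] [Nonempty ι] {P : Polytope n}
    {x : ι → EuclideanSpace ℝ (Fin n)} (hP : P.carrier = convexHull ℝ (Set.range x))
    (c : EuclideanSpace ℝ (Fin n)) : P.face c = convexHull ℝ (x '' argmax x c) := by
  obtain ⟨i, hi⟩ := argmax_nonempty x c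
  refine Set.Subset.antisymm (fun y hy => ?_) (convexHull_min ?_ fun y hy z hz a b ha hb hab => ?_)
  · have hy1 := hy.1
    rw [hP] at hy1
    refine mem_convexHull_image_argmax hy1 hi (hy.2 _ ?_)
    rw [hP]
    exact subset_convexHull ℝ _ (Set.mem_range_self i)
  · rintro _ ⟨j, hj, rfl⟩
    refine ⟨?_, fun y hy => ?_⟩
    · rw [hP]
      exact subset_convexHull ℝ _ (Set.mem_range_self j)
    · rw [hP] at hy
      exact inner_le_of_mem_convexHull_range hy hj
  · refine ⟨P.convex_carrier hy.1 hz.1 ha hb hab, fun w hw => ?_⟩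
    rw [inner_add_right, inner_smul_right, inner_smul_right, ← one_mul ⟪c, w⟫, ← hab, add_mul]
    exact add_le_add (mul_le_mul_of_nonneg_left (hy.2 w hw) ha)
      (mul_le_mul_of_nonneg_left (hz.2 w hw) hb)

theorem direction_affineSpan_face [Finite ι] [Nonempty ι] {P : Polytope n}
    {x : ι → EuclideanSpace ℝ (Fin n)} (hP : P.carrier = convexHull ℝ (Set.range x))
    (c : EuclideanSpace ℝ (Fin n)) :
    (affineSpan ℝ (P.face c)).direction = vectorSpan ℝ (x '' argmax x c) := by
  rw [face_eq_convexHull_image hP, affineSpan_convexHull, direction_affineSpan]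

theorem normallyEquivalent_of_argmax_eq [Finite ι] [Nonempty ι] {P Q : Polytope n}
    {x y : ι → EuclideanSpace ℝ (Fin n)} (hP : P.carrier = convexHull ℝ (Set.range x))
    (hQ : Q.carrier = convexHull ℝ (Set.range y)) (h : ∀ c, argmax x c = argmax y c) :
    P.NormallyEquivalent Q := by
  intro c
  rw [AffineSubspace.parallel_iff_direction_eq_and_eq_bot_iff_eq_bot]
  constructor
  · rw [direction_affineSpan_face hP, direction_affineSpan_face hQ]
    apply le_antisymm
    · rw [h c]
      exact vectorSpan_image_argmax_le h c
    · rw [← h c]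
      exact vectorSpan_image_argmax_le (fun c => (h c).symm) c
  · rw [affineSpan_eq_bot, affineSpan_eq_bot, face_eq_convexHull_image hP,
      face_eq_convexHull_image hQ, convexHull_eq_empty, convexHull_eq_empty]
    simp [(argmax_nonempty x c).ne_empty, (argmax_nonempty y c).ne_empty]

/-- This is how normal equivalence enters: the face in direction `c` is a point exactly if its
affine hull has trivial direction, a property invariant under parallelism. -/
theorem subsingleton_argmax_iff [Finite ι] [Nonempty ι] {P : Polytope n}
    {x : ι → EuclideanSpace ℝ (Fin n)} (hP : P.carrier = convexHull ℝ (Set.range x))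
    (hx : x.Injective) (c : EuclideanSpace ℝ (Fin n)) :
    (argmax x c).Subsingleton ↔ (affineSpan ℝ (P.face c)).direction = ⊥ := by
  rw [direction_affineSpan_face hP, vectorSpan_eq_bot_iff_subsingleton,
    hx.subsingleton_image_iff]

theorem NormallyEquivalent.exists_family [Finite ι] [Nonempty ι] {P Q : Polytope n}
    (h : Q.NormallyEquivalent P) {v : ι → EuclideanSpace ℝ (Fin n)}
    (hP : P.carrier = convexHull ℝ (Set.range v)) (hv : ∀ i, ∃ c, argmax v c = {i}) :
    ∃ x : ι → EuclideanSpace ℝ (Fin n), Q.carrier = convexHull ℝ (Set.range x) ∧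
      (∀ i, x i ∈ Q.vertices) ∧ ∀ c, argmax x c = argmax v c := by
  have := Q.finite_vertices.to_subtype
  have := Q.nonempty_vertices.to_subtype
  have hQ : Q.carrier = convexHull ℝ (Set.range (Subtype.val : Q.vertices → _)) := by
    rw [Subtype.range_coe, convexHull_vertices]
  obtain ⟨f, hf, hfa⟩ := exists_bijective_argmax_comp_eq hv
    Q.exists_argmax_vertices_eq_singleton fun c => by
      rw [subsingleton_argmax_iff hP (injective_of_exposed hv),
        subsingleton_argmax_iff hQ Subtype.val_injective, (h c).direction_eq]
  exact ⟨Subtype.val ∘ f, by rw [Set.range_comp, hf.2.range_eq, Set.image_univ, hQ],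
    fun i => (f i).2, hfa⟩

/-- The convex hull of a finite family of points. -/
def hull [Finite ι] [Nonempty ι] (x : ι → EuclideanSpace ℝ (Fin n)) : Polytope n where
  carrier := convexHull ℝ (Set.range x)
  exists_finset := ⟨(Set.finite_range x).toFinset, by simpa using Set.range_nonempty x, by simp⟩

variable [Finite ι] [Nonempty ι]

theorem vadd_hull (a : EuclideanSpace ℝ (Fin n)) (x : ι → EuclideanSpace ℝ (Fin n)) :
    a +ᵥ hull x = hull fun i => a + x i := by
  ext1
  rw [carrier_vadd, hull, hull, ← convexHull_vadd, ← Set.image_vadd, ← Set.range_comp]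
  rfl

theorem smul_hull (t : ℝ) (x : ι → EuclideanSpace ℝ (Fin n)) : t • hull x = hull (t • x) := by
  ext1
  rw [carrier_smul, hull, hull, ← convexHull_smul, ← Set.image_smul, ← Set.range_comp]
  rfl

/-- Common maximizers make the support function of the sum the one of the family `x + y`; the other
inclusion holds pointwise on generators. -/
theorem hull_add_hull {x y : ι → EuclideanSpace ℝ (Fin n)} (h : ∀ c, argmax x c = argmax y c) :
    hull x + hull y = hull (x + y) := by
  ext1
  refine Set.Subset.antisymm (subset_convexHull_range fun c => ?_)
    (convexHull_min ?_ (hull x + hull y).convex_carrier)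
  · obtain ⟨i, hi⟩ := argmax_nonempty x c
    refine ⟨i, ?_⟩
    rintro _ ⟨p, hp, q, hq, rfl⟩
    rw [Pi.add_apply, inner_add_right, inner_add_right]
    exact add_le_add (inner_le_of_mem_convexHull_range hp hi)
      (inner_le_of_mem_convexHull_range hq (h c ▸ hi))
  · rintro _ ⟨i, rfl⟩
    exact Set.add_mem_add (subset_convexHull ℝ _ (Set.mem_range_self i))
      (subset_convexHull ℝ _ (Set.mem_range_self i))

variable {v x y : ι → EuclideanSpace ℝ (Fin n)}

theorem vadd_add_vadd (a b : EuclideanSpace ℝ (Fin n)) (P Q : Polytope n) :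
    (a +ᵥ P) + (b +ᵥ Q) = (a + b) +ᵥ (P + Q) := by
  ext1
  simp only [carrier_add, carrier_vadd, ← Set.singleton_vadd, vadd_eq_add,
    ← Set.singleton_add_singleton]
  abel

theorem vectorSpan_range_le (h : ∀ c, argmax x c = argmax y c) :
    vectorSpan ℝ (Set.range x) ≤ vectorSpan ℝ (Set.range y) := by
  -- In direction `0` every index is a maximizer.
  simpa [argmax_zero] using vectorSpan_image_argmax_le h 0

theorem isCenter_hull (hv : ∀ i, ∃ c, argmax v c = {i}) (hx : x ∈ inscribedFamilies v) :
    (hull x).IsCenter 0 := by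
  obtain ⟨i⟩ := ‹Nonempty ι›
  constructor
  · have h1 : x i ∈ affineSpan ℝ (Set.range x) :=
      subset_affineSpan ℝ _ (Set.mem_range_self i)
    have h2 : -x i ∈ (affineSpan ℝ (Set.range x)).direction := by
      rw [direction_affineSpan]
      exact neg_mem (vectorSpan_range_le (fun c => (hx.1 c).symm) (hx.2.1 i))
    rw [hull, affineSpan_convexHull]
    simpa using AffineSubspace.vadd_mem_of_mem_direction h2 h1
  · refine ⟨‖x i‖, fun w hw => ?_⟩
    obtain ⟨j, rfl⟩ := extremePoints_convexHull_subset hw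
    rw [dist_zero_right, norm_eq_of_mem_inscribedSubmodule hv hx.2 j i]

theorem isInscribed_hull (hv : ∀ i, ∃ c, argmax v c = {i}) (hx : x ∈ inscribedFamilies v) :
    (hull x).IsInscribed :=
  ⟨0, (isCenter_hull hv hx).2⟩

theorem centered_hull (hv : ∀ i, ∃ c, argmax v c = {i}) (hx : x ∈ inscribedFamilies v) :
    (hull x).centered = hull x := by
  ext1
  rw [centered, (isCenter_hull hv hx).center_eq, neg_zero, carrier_vadd, zero_vadd]

theorem normallyEquivalent_vadd_hull {P : Polytope n}
    (hP : P.carrier = convexHull ℝ (Set.range v)) (h : ∀ c, argmax x c = argmax v c)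
    (a : EuclideanSpace ℝ (Fin n)) : (a +ᵥ hull x).NormallyEquivalent P := by
  rw [vadd_hull]
  refine normallyEquivalent_of_argmax_eq rfl hP fun c => ?_
  rw [← h c, ← argmax_sub_const x (-a)]
  simp [add_comm]

/-- An inscribed polytope that is normally equivalent to `P` is a translate of the convex hull of
a family in `inscribedFamilies`. -/
theorem NormallyEquivalent.exists_eq_vadd_hull {P Q : Polytope n} (h : Q.NormallyEquivalent P)
    (hQ : Q.IsInscribed) (hP : P.carrier = convexHull ℝ (Set.range v))
    (hv : ∀ i, ∃ c, argmax v c = {i}) :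
    ∃ x ∈ inscribedFamilies v, ∃ a : EuclideanSpace ℝ (Fin n), Q = a +ᵥ hull x := by
  obtain ⟨y, hy, hyQ, hyv⟩ := h.exists_family hP hv
  obtain ⟨a, ha, r, hr⟩ := hQ.exists_isCenter
  have hsub : ∀ c, argmax (fun i => y i - a) c = argmax v c := fun c => by
    rw [argmax_sub_const, hyv]
  refine ⟨fun i => y i - a, ⟨hsub, mem_inscribedSubmodule_of_norm_eq hv hsub (fun i => ?_)
    fun i j => ?_⟩, a, ?_⟩
  · refine vectorSpan_range_le hyv ?_
    rw [hy, affineSpan_convexHull] at ha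
    rw [← direction_affineSpan]
    exact AffineSubspace.vsub_mem_direction (subset_affineSpan ℝ _ (Set.mem_range_self i)) ha
  · rw [← dist_eq_norm, ← dist_eq_norm, hr _ (hyQ i), hr _ (hyQ j)]
  · rw [vadd_hull]
    ext1
    simp [hull, hy]

/-- Equal hulls have Hausdorff distance zero, and the Lipschitz bound then identifies each vertex.
-/
theorem hull_injOn (hv : ∀ i, ∃ c, argmax v c = {i}) :
    Set.InjOn hull {x : ι → EuclideanSpace ℝ (Fin n) | ∀ c, argmax x c = argmax v c} := by
  intro x hx y hy hxy
  ext1 i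
  obtain ⟨K, hK⟩ := exists_norm_sub_le_of_exposed (hv i)
  have h := hK x y hx hy
  rw [show convexHull ℝ (Set.range x) = convexHull ℝ (Set.range y) from congrArg carrier hxy,
    Metric.hausdorffDist_self_zero, mul_zero] at h
  exact sub_eq_zero.1 (norm_le_zero_iff.1 h)

/-- The point of the inscribed cone of `P` given by a family in `inscribedFamilies`. -/
def inConeMk {P : Polytope n} (hP : P.carrier = convexHull ℝ (Set.range v))
    (hv : ∀ i, ∃ c, argmax v c = {i}) (x : inscribedFamilies v) : P.InCone :=
  ⟨TranslationClass.mk (hull x.1), hull x.1, normallyEquivalent_of_argmax_eq rfl hP x.2.1,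
    isInscribed_hull hv x.2, rfl⟩

theorem centeredRep_inConeMk {P : Polytope n} (hP : P.carrier = convexHull ℝ (Set.range v))
    (hv : ∀ i, ∃ c, argmax v c = {i}) (x : inscribedFamilies v) :
    (inConeMk hP hv x : TranslationClass n).centeredRep = hull x.1 := by
  rw [inConeMk, TranslationClass.centeredRep_mk (isInscribed_hull hv x.2), centered_hull hv x.2]

theorem inConeMk_bijective {P : Polytope n} (hP : P.carrier = convexHull ℝ (Set.range v))
    (hv : ∀ i, ∃ c, argmax v c = {i}) : Function.Bijective (inConeMk hP hv) := by
  refine ⟨fun x y hxy => Subtype.ext (hull_injOn hv x.2.1 y.2.1 ?_), ?_⟩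
  · rw [← centeredRep_inConeMk hP hv, hxy, centeredRep_inConeMk]
  · rintro ⟨_, Q, hQP, hQ, rfl⟩
    obtain ⟨x, hx, a, rfl⟩ := hQP.exists_eq_vadd_hull hQ hP hv
    exact ⟨⟨x, hx⟩, Subtype.ext (Quotient.sound ⟨a, rfl⟩)⟩

theorem dist_inConeMk {P : Polytope n} (hP : P.carrier = convexHull ℝ (Set.range v))
    (hv : ∀ i, ∃ c, argmax v c = {i}) (x y : inscribedFamilies v) :
    dist (inConeMk hP hv x) (inConeMk hP hv y) =
      Metric.hausdorffDist (convexHull ℝ (Set.range x.1)) (convexHull ℝ (Set.range y.1)) := by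
  change dist (inConeMk hP hv x : TranslationClass n).centeredRep.toNonemptyCompacts
    (inConeMk hP hv y : TranslationClass n).centeredRep.toNonemptyCompacts = _
  rw [centeredRep_inConeMk, centeredRep_inConeMk]
  rfl

/-- The inscribed cone is parametrized by the position of one vertex. -/
theorem exists_homeomorph_image {P : Polytope n} (hP : P.carrier = convexHull ℝ (Set.range v))
    (hv : ∀ i, ∃ c, argmax v c = {i}) (i : ι) :
    ∃ φ : P.InCone ≃ₜ
      ((LinearMap.proj i : (ι → EuclideanSpace ℝ (Fin n)) →ₗ[ℝ] _) '' inscribedFamilies v),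
      ∀ x, (φ (inConeMk hP hv x) : EuclideanSpace ℝ (Fin n)) = x.1 i := by
  have := Fintype.ofFinite ι
  obtain ⟨r, hr⟩ := exists_linearMap_apply_eq hv i
  obtain ⟨K, hK⟩ := exists_norm_sub_le_of_exposed (hv i)
  have hinj : Set.InjOn (LinearMap.proj i : (ι → EuclideanSpace ℝ (Fin n)) →ₗ[ℝ] _)
      (inscribedFamilies v) := fun x hx y hy hxy => by
    rw [← hr x hx.2, ← hr y hy.2]
    exact congrArg r hxy
  let e₁ := Equiv.ofBijective _ (inConeMk_bijective hP hv)
  let e₂ := Equiv.Set.imageOfInjOn _ _ hinj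
  have hφ : ∀ x, ((e₁.symm.trans e₂) (inConeMk hP hv x) : EuclideanSpace ℝ (Fin n)) = x.1 i := by
    intro x
    have : e₁.symm (inConeMk hP hv x) = x := e₁.symm_apply_apply x
    rw [Equiv.trans_apply, this]
    rfl
  refine ⟨⟨e₁.symm.trans e₂, ?_, ?_⟩, hφ⟩
  · refine (LipschitzWith.of_dist_le' (K := K) fun q q' => ?_).continuous
    obtain ⟨x, rfl⟩ := (inConeMk_bijective hP hv).2 q
    obtain ⟨y, rfl⟩ := (inConeMk_bijective hP hv).2 q'
    rw [dist_inConeMk, Subtype.dist_eq]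
    change dist ((e₁.symm.trans e₂) (inConeMk hP hv x) : EuclideanSpace ℝ (Fin n))
      ((e₁.symm.trans e₂) (inConeMk hP hv y)) ≤ _
    rw [hφ, hφ, dist_eq_norm]
    exact hK _ _ x.2.1 y.2.1
  · have h1 : Continuous (inConeMk hP hv) := by
      refine (LipschitzWith.of_dist_le' (K := 1) fun x y => ?_).continuous
      rw [dist_inConeMk, one_mul]
      exact hausdorffDist_convexHull_range_le _ _
    -- The inverse of evaluation at `i` is the restriction of the linear map `r`, continuous by
    -- finite dimension.
    have h2 : Continuous e₂.symm := by
      have hrc : Continuous r := r.continuous_of_finiteDimensional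
      refine Continuous.subtype_mk (hrc.comp continuous_subtype_val) ?_ |>.congr ?_
      · rintro ⟨_, x, hx, rfl⟩
        change r (x i) ∈ _
        rw [hr x hx.2]
        exact hx
      · rintro ⟨_, x, hx, rfl⟩
        rw [Equiv.eq_symm_apply]
        refine Subtype.ext ?_
        change r (x i) i = x i
        rw [hr x hx.2]
    exact h1.comp h2

end Polytope

open Polytope in
theorem theorem1p1 (n d : ℕ) (P : Polytope n) (hP : P.dim = d) :
    (∀ Q Q' : Polytope n,
      Q.NormallyEquivalent P → Q.IsInscribed → Q'.NormallyEquivalent P → Q'.IsInscribed →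
        (Q + Q').NormallyEquivalent P ∧ (Q + Q').IsInscribed) ∧
    ∃ C : Set (EuclideanSpace ℝ (Fin n)),
      IsOpenPolyhedralCone C ∧ Module.finrank ℝ (Submodule.span ℝ C) ≤ d ∧
      ∃ φ : P.InCone ≃ₜ C,
        (∀ q q' : P.InCone, ∃ h : (q : TranslationClass n) + q' ∈ P.InCone,
          (φ ⟨q + q', h⟩ : EuclideanSpace ℝ (Fin n)) = φ q + φ q') ∧
        (∀ t : ℝ, 0 < t → ∀ q : P.InCone, ∃ h : t • (q : TranslationClass n) ∈ P.InCone,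
          (φ ⟨t • (q : TranslationClass n), h⟩ : EuclideanSpace ℝ (Fin n)) =
            t • (φ q : EuclideanSpace ℝ (Fin n))) := by
  have := P.finite_vertices.to_subtype
  have := P.nonempty_vertices.to_subtype
  have hv := P.exists_argmax_vertices_eq_singleton
  set v : P.vertices → EuclideanSpace ℝ (Fin n) := Subtype.val with hvdef
  have hPv : P.carrier = convexHull ℝ (Set.range v) := by
    rw [hvdef, Subtype.range_coe, convexHull_vertices]
  obtain ⟨i⟩ := ‹Nonempty P.vertices›
  obtain ⟨r, hr⟩ := exists_linearMap_apply_eq hv i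
  obtain ⟨φ, hφ⟩ := exists_homeomorph_image hPv hv i
  refine ⟨fun Q Q' hQP hQ hQP' hQ' => ?_, _,
    (isOpenPolyhedralCone_inscribedFamilies v).image Set.inter_subset_right hr, ?_, φ, ?_, ?_⟩
  · obtain ⟨x, hx, a, rfl⟩ := hQP.exists_eq_vadd_hull hQ hPv hv
    obtain ⟨y, hy, b, rfl⟩ := hQP'.exists_eq_vadd_hull hQ' hPv hv
    have hxy := add_mem_inscribedFamilies hx hy
    rw [vadd_add_vadd, hull_add_hull fun c => (hx.1 c).trans (hy.1 c).symm]
    exact ⟨normallyEquivalent_vadd_hull hPv hxy.1 _, (isInscribed_hull hv hxy).vadd _⟩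
  -- Families in the cone take values in the direction space of the affine hull of `P`, whose
  -- dimension is `d`.
  · have hspan : Submodule.span ℝ ((LinearMap.proj i :
        (P.vertices → EuclideanSpace ℝ (Fin n)) →ₗ[ℝ] _) '' inscribedFamilies v) ≤
        vectorSpan ℝ (Set.range v) := by
      rw [Submodule.span_le]
      rintro _ ⟨x, hx, rfl⟩
      exact hx.2.1 i
    refine (Submodule.finrank_mono hspan).trans ?_
    rw [← hP, dim, hPv, affineSpan_convexHull, direction_affineSpan]
  · intro q q'
    obtain ⟨x, rfl⟩ := (inConeMk_bijective hPv hv).2 q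
    obtain ⟨y, rfl⟩ := (inConeMk_bijective hPv hv).2 q'
    let z : inscribedFamilies v := ⟨x.1 + y.1, add_mem_inscribedFamilies x.2 y.2⟩
    have hz : (inConeMk hPv hv x : TranslationClass n) + inConeMk hPv hv y = inConeMk hPv hv z := by
      change TranslationClass.mk (hull x.1 + hull y.1) = TranslationClass.mk (hull (x.1 + y.1))
      rw [hull_add_hull fun c => (x.2.1 c).trans (y.2.1 c).symm]
    refine ⟨hz ▸ (inConeMk hPv hv z).2, ?_⟩
    rw [show (⟨_, hz ▸ (inConeMk hPv hv z).2⟩ : P.InCone) = inConeMk hPv hv z from Subtype.ext hz,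
      hφ, hφ, hφ]
    rfl
  · intro t ht q
    obtain ⟨x, rfl⟩ := (inConeMk_bijective hPv hv).2 q
    let z : inscribedFamilies v := ⟨t • x.1, smul_mem_inscribedFamilies x.2 ht⟩
    have hz : t • (inConeMk hPv hv x : TranslationClass n) = inConeMk hPv hv z := by
      change TranslationClass.mk (t • hull x.1) = TranslationClass.mk (hull (t • x.1))
      rw [smul_hull]
    refine ⟨hz ▸ (inConeMk hPv hv z).2, ?_⟩
    rw [show (⟨_, hz ▸ (inConeMk hPv hv z).2⟩ : P.InCone) = inConeMk hPv hv z from Subtype.ext hz,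
      hφ, hφ]
    rfl
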